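/- Let $M,C,K\in\mathbb R^{n\times n}$ with $M$ invertible, let $F:\mathbb R\to\mathbb R^n$ be four times continuously differentiable, and consider $$M\ddot q+C\dot q+Kq=F(t),\qquad q(0)=q_0,\ \dot q(0)=v_0, \tag{1}$$ in the autonomous form $\dot y=f(y)$, $y=(\tau,q,v)$, $f(\tau,q,v)=\bigl(1,\,v,\,-M^{-1}(Cv+Kq-F(\tau))\bigr)$. The Newmark scheme with parameters $\beta,\gamma$ and step $\Delta t$ is $\tau^{j+1}=\tau^j+\Delta t$, $q^{j+1}=q^j+\Delta t\,v^j+\frac{\Delta t^2}{2}[(1-2\beta)a^j+2\beta a^{j+1}]$, $v^{j+1}=v^j+\Delta t[(1-\gamma)a^j+\gamma a^{j+1}]$, where $Ma^j+Cv^j+Kq^j=F(\tau^j)$ for all $j$. For constant matrices $C_2,K_2$ and a continuous function $F_2$, the *compensated scheme* is the Newmark scheme with $C,K,F$ replaced by $C+\Delta t^2C_2$, $K+\Delta t^2K_2$, $F+\Delta t^2F_2$. We say that a scheme has the distorted vector field $\sum_{k<p}\Delta t^kg_k+O(\Delta t^p)$, with $C^1$ vector fields $g_k$, if for all sufficiently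 small $\Delta t>0$, uniformly for starting points in a compact set, the step is uniquely solvable and differs by $O(\Delta t^{p+1})$ from the time-$\Delta t$ flow of $\dot y=\sum_{k<p}\Delta t^kg_k(y)$. We say that it is accurate of order $p$ for (1) if, for all $q_0,v_0$ and $T>0$, for all sufficiently small $\Delta t>0$ the scheme started at $(0,q_0,v_0)$ is uniquely executable and $\|q^j-q(j\Delta t)\|,\ \|v^j-\dot q(j\Delta t)\|\le c\,\Delta t^p$ whenever $0\le j\Delta t\le T$, where $q$ is the solution of (1) and $c$ does not depend on $\Delta t$ and $j$. Put $G=M^{-1}C$, $H=M^{-1}K$ and $A(\tau,q,v)=-GHq+(H-G^2)v+GM^{-1}F(\tau)-M^{-1}F'(\tau)$. Then: 1. Let $\gamma=1/2$, and let $\beta\in\mathbb R$, $C_2,K_2$ and continuous $F_2$ be arbitrary. If $A$ does not vanish identically and the compensated scheme has the distorted vector field $f+O(\Delta t^4)$ (that is, $g_0=f$, $g_1=g_2=g_3=0$), then $\beta=1/6$. If $A(\tau,q,v)\neq0$ for some $\tau\ge0$ and some $q,v$, and the compensated scheme is accurate of order $4$ for (1), then $\beta=1/6$. 2. Let $\gamma=1/2$,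 $\beta=1/6$, and compensate by $$\hat C=C+\tfrac{\Delta t^2}{12}\bigl(CM^{-1}K+KM^{-1}C-CM^{-1}CM^{-1}C\bigr),\qquad \hat K=K+\tfrac{\Delta t^2}{12}\bigl(KM^{-1}K-CM^{-1}CM^{-1}K\bigr),$$ $$\hat F(t)=F(t)+\tfrac{\Delta t^2}{12}\Bigl(KM^{-1}F(t)-F''(t)-CM^{-1}\bigl(CM^{-1}F(t)-F'(t)\bigr)\Bigr).$$ Then the distorted vector field of the compensated scheme is $f+O(\Delta t^4)$, with uniquely determined coefficients: the scheme has the distorted vector field $\sum_{k<4}\Delta t^kg_k+O(\Delta t^4)$ if and only if $g_0=f$ and $g_1=g_2=g_3=0$. Moreover, the compensated scheme is accurate of order $4$ for the original system (1). -/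

import Mathlib

open Matrix

namespace Newmark

/-- A state `(τ, q, v)`: time, generalized coordinates and velocities. -/
abbrev State (n : ℕ) : Type := ℝ × (Fin n → ℝ) × (Fin n → ℝ)

/-- The autonomous first-order form `τ' = 1`, `q' = v`, `v' = -M⁻¹ (C v + K q - F(τ))` of the
equation of motion `M q'' + C q' + K q = F(t)`. -/
noncomputable def vectorField {n : ℕ} (M C K : Matrix (Fin n) (Fin n) ℝ) (F : ℝ → Fin n → ℝ) :
    State n → State n :=
  fun y => (1, y.2.2, -(M⁻¹ *ᵥ (C *ᵥ y.2.2 + K *ᵥ y.2.1 - F y.1)))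

/-- `(q, v)` is a solution for `t ≥ 0` of `M q'' + C q' + K q = F(t)`, `v = q'`, with
`q(0) = q₀` and `q'(0) = v₀` (one-sided derivatives at `t = 0`). -/
def IsMotion {n : ℕ} (M C K : Matrix (Fin n) (Fin n) ℝ) (F : ℝ → Fin n → ℝ)
    (q₀ v₀ : Fin n → ℝ) (q v : ℝ → Fin n → ℝ) : Prop :=
  q 0 = q₀ ∧ v 0 = v₀ ∧ ∀ t : ℝ, 0 ≤ t →
    HasDerivWithinAt q (v t) (Set.Ici 0) t ∧
    ∃ a : Fin n → ℝ, HasDerivWithinAt v a (Set.Ici 0) t ∧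
      M *ᵥ a + C *ᵥ v t + K *ᵥ q t = F t

/-- One (implicit) step of length `h` of the Newmark scheme with parameters `β`, `γ` leads from the
state `y` to the state `y'`; `a` and `a'` are the accelerations at the two ends of the step. -/
def IsStep {n : ℕ} (M C K : Matrix (Fin n) (Fin n) ℝ) (F : ℝ → Fin n → ℝ) (β γ h : ℝ)
    (y y' : State n) : Prop :=
  ∃ a a' : Fin n → ℝ,
    M *ᵥ a + C *ᵥ y.2.2 + K *ᵥ y.2.1 = F y.1 ∧
    M *ᵥ a' + C *ᵥ y'.2.2 + K *ᵥ y'.2.1 = F y'.1 ∧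
    y'.1 = y.1 + h ∧
    y'.2.1 = y.2.1 + h • y.2.2 + (h ^ 2 / 2) • ((1 - 2 * β) • a + (2 * β) • a') ∧
    y'.2.2 = y.2.2 + h • ((1 - γ) • a + γ • a')

/-- The Newmark step of length `h` applied to the system with mass matrix `M`, damping matrix
`C + h² C₂`, stiffness matrix `K + h² K₂` and excitation `F + h² F₂`. -/
def IsCompensatedStep {n : ℕ} (M C K C₂ K₂ : Matrix (Fin n) (Fin n) ℝ) (F F₂ : ℝ → Fin n → ℝ)
    (β γ h : ℝ) (y y' : State n) : Prop :=
  IsStep M (C + h ^ 2 • C₂) (K + h ^ 2 • K₂) (fun t => F t + h ^ 2 • F₂ t) β γ h y y'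

/-- The Newmark scheme with steps `S h` and initial state `(0, q₀, v₀)` generates `y⁰, y¹, …`. -/
def IsRun {n : ℕ} (S : State n → State n → Prop) (q₀ v₀ : Fin n → ℝ) (y : ℕ → State n) : Prop :=
  y 0 = (0, q₀, v₀) ∧ ∀ j : ℕ, S (y j) (y (j + 1))

/-- The one-step method `S` (a step relation for every step length `h`) has the distorted
vector field `∑_{k < p} h ^ k g k + O(h ^ p)`: for small `h` the step is uniquely solvable, and the
exact flow over time `h` of the truncated distorted equation `y' = ∑_{k < p} h ^ k g k (y)`
reproduces it up to `O(h ^ (p + 1))`, uniformly on compact sets of starting points. -/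
def IsDistortedExpansion {n : ℕ} (S : ℝ → State n → State n → Prop) (p : ℕ)
    (g : ℕ → State n → State n) : Prop :=
  (∀ k < p, ContDiff ℝ 1 (g k)) ∧
  ∀ Ω : Set (State n), IsCompact Ω →
    ∃ c h₀ : ℝ, 0 < c ∧ 0 < h₀ ∧ ∀ h : ℝ, 0 < h → h ≤ h₀ → ∀ x ∈ Ω,
      ∃ (x' : State n) (y : ℝ → State n),
        S h x x' ∧ (∀ z : State n, S h x z → z = x') ∧
        y 0 = x ∧
        (∀ t ∈ Set.Icc 0 h,
          HasDerivWithinAt y (∑ k ∈ Finset.range p, h ^ k • g k (y t)) (Set.Icc 0 h) t) ∧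
        ‖x' - y h‖ ≤ c * h ^ (p + 1)

/-- The method `S`, started at time `0`, is accurate of order `p` for the initial value problem
`M q'' + C q' + K q = F(t)`: on every time interval `[0, T]` and for every initial value, the
method is uniquely executable for small `h`, and the errors of position and velocity at the
grid points are `O(h ^ p)`. -/
def IsAccurateOfOrder {n : ℕ} (S : ℝ → State n → State n → Prop)
    (M C K : Matrix (Fin n) (Fin n) ℝ) (F : ℝ → Fin n → ℝ) (p : ℕ) : Prop :=
  ∀ (q₀ v₀ : Fin n → ℝ) (q v : ℝ → Fin n → ℝ), IsMotion M C K F q₀ v₀ q v →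
    ∀ T : ℝ, 0 < T → ∃ c h₀ : ℝ, 0 < c ∧ 0 < h₀ ∧ ∀ h : ℝ, 0 < h → h ≤ h₀ →
      ∃ y : ℕ → State n, IsRun (S h) q₀ v₀ y ∧
        (∀ z : ℕ → State n, IsRun (S h) q₀ v₀ z → z = y) ∧
        ∀ j : ℕ, (j : ℝ) * h ≤ T →
          ‖(y j).2.1 - q (j * h)‖ ≤ c * h ^ p ∧ ‖(y j).2.2 - v (j * h)‖ ≤ c * h ^ p

/-- The vector `A(τ, q, v) = -G H q + (H - G²) v + G M⁻¹ F(τ) - M⁻¹ F'(τ)` with `G = M⁻¹ C`,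
`H = M⁻¹ K`; it is minus the third derivative of `q` along solutions of the equation of motion. -/
noncomputable def A {n : ℕ} (M C K : Matrix (Fin n) (Fin n) ℝ) (F : ℝ → Fin n → ℝ)
    (τ : ℝ) (q v : Fin n → ℝ) : Fin n → ℝ :=
  (M⁻¹ * K - (M⁻¹ * C) * (M⁻¹ * C)) *ᵥ v - ((M⁻¹ * C) * (M⁻¹ * K)) *ᵥ q +
    (M⁻¹ * C) *ᵥ (M⁻¹ *ᵥ F τ) - M⁻¹ *ᵥ deriv F τ

/-- The damping compensation term. -/
noncomputable def dampingTerm {n : ℕ} (M C K : Matrix (Fin n) (Fin n) ℝ) :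
    Matrix (Fin n) (Fin n) ℝ :=
  (1 / 12 : ℝ) • (C * M⁻¹ * K + K * M⁻¹ * C - C * M⁻¹ * C * M⁻¹ * C)

/-- The stiffness compensation term. -/
noncomputable def stiffnessTerm {n : ℕ} (M C K : Matrix (Fin n) (Fin n) ℝ) :
    Matrix (Fin n) (Fin n) ℝ :=
  (1 / 12 : ℝ) • (K * M⁻¹ * K - C * M⁻¹ * C * M⁻¹ * K)

/-- The excitation compensation term. -/
noncomputable def excitationTerm {n : ℕ} (M C K : Matrix (Fin n) (Fin n) ℝ)
    (F : ℝ → Fin n → ℝ) (t : ℝ) : Fin n → ℝ :=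
  (1 / 12 : ℝ) • ((K * M⁻¹) *ᵥ F t - deriv (deriv F) t -
    (C * M⁻¹) *ᵥ ((C * M⁻¹) *ᵥ F t - deriv F t))

end Newmark

/-!
After multiplication by `M⁻¹` the equation of motion reads `q' = v`, `v' = f + L (q, v)` with a
linear map `L` and `f = M⁻¹ F`, and the derivatives of `q` along its solutions are the functions
`jet` of time and state, with `jet 2` the acceleration and `jet 3 = -A`. A compensated Newmark step
is a zero of a `residual` that depends on the two end states in an affine way. For small `h` this
makes the step a contraction in its unknown, hence uniquely solvable, and stable
(`norm_sub_le_of_residual`), so that everything is decided by the residual of exact solutions.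

Taylor expansion gives this residual. Its position component is `h³ (1 / 6 - β) jet 3 + O(h⁴)`,
however the accelerations are changed at order `h²` (`norm_position_defect_le`). For
`β = 1 / 6`, `γ = 1 / 2` the rest of the residual up to order four is removed if the accelerations
are corrected by `-h² / 12` times their second derivative `jet 4` (`norm_fifth_order_defect_le`),
and the given compensation of damping, stiffness and excitation does exactly this
(`compensation_eq_jet`).

If the distorted vector field is `f + O(h⁴)`, the residual of each exact solution is `O(h⁵)`. If the
scheme is accurate of order four, the values at two consecutive grid points show that it is
`O(h⁴)`. Either way `(1 / 6 - β) A` vanishes. Conversely, a residual `O(h⁵)` and stability give the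
local error `O(h⁵)`, uniformly on compact sets by Gronwall's inequality, and summation over the
steps gives the global error `O(h⁴)`.

Uniqueness of the coefficients is a fact about flows: if the first `m` coefficients of two
truncated distorted equations agree, their solutions differ after time `h` by `h ^ (m + 1)` times
the difference of the coefficients number `m`, up to `o(h ^ (m + 1))`
(`coefficient_eq_of_flows_close`).
-/


namespace Newmark

/-! ### The step equations as the zero set of a residual -/

section Residual

variable {V : Type*} [NormedAddCommGroup V] [NormedSpace ℝ V]

/-- The increment, divided by the step length `h`, of positions and velocities in a Newmark step
with initial velocity `v` and accelerations `a`, `a'` at the ends of the step. -/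
noncomputable def increment (β γ h : ℝ) (v a a' : V) : V × V :=
  (v + (h / 2) • ((1 - 2 * β) • a + (2 * β) • a'), (1 - γ) • a + γ • a')

/-- A bound for the norm of `increment β γ h`, valid for all `0 ≤ h ≤ 1`. -/
noncomputable def incrementBound (β γ : ℝ) : ℝ :=
  1 + |1 - 2 * β| + |2 * β| + |1 - γ| + |γ|

/-- The acceleration at time `t` and state `z = (q, v)` in the compensated system, for the linear
part `L + h² L₂` and the excitation `f + h² φ`, both already multiplied by the inverse of the mass
matrix. -/
noncomputable def accel (L L₂ : V × V →L[ℝ] V) (f φ : ℝ → V) (h t : ℝ) (z : V × V) : V :=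
  f t + L z + h ^ 2 • (φ t + L₂ z)

/-- The defect that the pair `(z, z')` leaves in the equations of a compensated Newmark step from
time `t` to time `t + h`; the step leads from `z` to `z'` exactly if the residual vanishes. -/
noncomputable def residual (L L₂ : V × V →L[ℝ] V) (f φ : ℝ → V) (β γ h t : ℝ) (z z' : V × V) :
    V × V :=
  z' - z - h • increment β γ h z.2 (accel L L₂ f φ h t z) (accel L L₂ f φ h (t + h) z')

/-- A Lipschitz constant, valid for all `0 ≤ h ≤ 1`, of the increment of a compensated step as a
function of its two end states. -/
noncomputable def stepLipschitz (L L₂ : V × V →L[ℝ] V) (β γ : ℝ) : ℝ :=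
  incrementBound β γ * (1 + ‖L‖ + ‖L₂‖)

theorem one_le_incrementBound (β γ : ℝ) : 1 ≤ incrementBound β γ := by
  have h1 := abs_nonneg (1 - 2 * β)
  have h2 := abs_nonneg (2 * β)
  have h3 := abs_nonneg (1 - γ)
  have h4 := abs_nonneg γ
  unfold incrementBound
  linarith

theorem one_le_stepLipschitz (L L₂ : V × V →L[ℝ] V) (β γ : ℝ) : 1 ≤ stepLipschitz L L₂ β γ := by
  have h1 := one_le_incrementBound β γ
  have h2 := norm_nonneg L
  have h3 := norm_nonneg L₂
  unfold stepLipschitz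
  nlinarith

theorem increment_sub (β γ h : ℝ) (v a a' w b b' : V) :
    increment β γ h v a a' - increment β γ h w b b' =
      increment β γ h (v - w) (a - b) (a' - b') := by
  unfold increment
  ext
  · simp only [Prod.fst_sub]; module
  · simp only [Prod.snd_sub]; module

theorem norm_increment_le {β γ h : ℝ} (h0 : 0 ≤ h) (h1 : h ≤ 1) (v a a' : V) :
    ‖increment β γ h v a a'‖ ≤ incrementBound β γ * (‖v‖ + ‖a‖ + ‖a'‖) := by
  have e1 := abs_nonneg (1 - 2 * β)
  have e2 := abs_nonneg (2 * β)
  have e3 := abs_nonneg (1 - γ)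
  have e4 := abs_nonneg γ
  have n1 := norm_nonneg v
  have n2 := norm_nonneg a
  have n3 := norm_nonneg a'
  have p : ∀ x y : ℝ, ‖x • a + y • a'‖ ≤ |x| * ‖a‖ + |y| * ‖a'‖ := fun x y => by
    simpa only [norm_smul, Real.norm_eq_abs] using norm_add_le (x • a) (y • a')
  refine norm_prod_le_iff.2 ⟨?_, ?_⟩
  · have q : ‖(h / 2) • ((1 - 2 * β) • a + (2 * β) • a')‖ ≤
        |1 - 2 * β| * ‖a‖ + |2 * β| * ‖a'‖ := by
      rw [norm_smul, Real.norm_eq_abs, abs_of_nonneg (by linarith)]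
      refine le_trans ?_ (p _ _)
      exact mul_le_of_le_one_left (norm_nonneg _) (by linarith)
    refine (norm_add_le _ _).trans ?_
    unfold incrementBound
    nlinarith [mul_nonneg e1 n1, mul_nonneg e2 n1, mul_nonneg e3 n1, mul_nonneg e4 n1,
      mul_nonneg e2 n2, mul_nonneg e3 n2, mul_nonneg e4 n2,
      mul_nonneg e1 n3, mul_nonneg e3 n3, mul_nonneg e4 n3]
  · refine (p _ _).trans ?_
    unfold incrementBound
    nlinarith [mul_nonneg e1 n1, mul_nonneg e2 n1, mul_nonneg e3 n1, mul_nonneg e4 n1,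
      mul_nonneg e2 n2, mul_nonneg e1 n2, mul_nonneg e4 n2,
      mul_nonneg e1 n3, mul_nonneg e3 n3, mul_nonneg e2 n3]

variable (L L₂ : V × V →L[ℝ] V) (f φ : ℝ → V) (β γ : ℝ)

theorem norm_accel_sub_le {h : ℝ} (h0 : 0 ≤ h) (h1 : h ≤ 1) (t : ℝ) (z w : V × V) :
    ‖accel L L₂ f φ h t z - accel L L₂ f φ h t w‖ ≤ (‖L‖ + ‖L₂‖) * ‖z - w‖ := by
  have e : accel L L₂ f φ h t z - accel L L₂ f φ h t w = L (z - w) + h ^ 2 • L₂ (z - w) := by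
    unfold accel
    rw [map_sub, map_sub]
    module
  have e2 : ‖h ^ 2 • L₂ (z - w)‖ ≤ ‖L₂‖ * ‖z - w‖ := by
    rw [norm_smul, Real.norm_eq_abs, abs_of_nonneg (by positivity)]
    exact (mul_le_of_le_one_left (norm_nonneg _) (pow_le_one₀ h0 h1)).trans (L₂.le_opNorm _)
  rw [e, add_mul]
  exact (norm_add_le _ _).trans (add_le_add (L.le_opNorm _) e2)

theorem norm_residual_sub_le {h : ℝ} (h0 : 0 ≤ h) (h1 : h ≤ 1) (t : ℝ) (z z' w w' : V × V) :
    ‖residual L L₂ f φ β γ h t z z' - residual L L₂ f φ β γ h t w w' - ((z' - w') - (z - w))‖ ≤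
      h * stepLipschitz L L₂ β γ * (‖z - w‖ + ‖z' - w'‖) := by
  have e : residual L L₂ f φ β γ h t z z' - residual L L₂ f φ β γ h t w w'
      - ((z' - w') - (z - w)) = -(h • increment β γ h (z.2 - w.2)
        (accel L L₂ f φ h t z - accel L L₂ f φ h t w)
        (accel L L₂ f φ h (t + h) z' - accel L L₂ f φ h (t + h) w')) := by
    rw [← increment_sub]
    unfold residual
    module
  rw [e, norm_neg, norm_smul, Real.norm_eq_abs, abs_of_nonneg h0, mul_assoc]
  refine mul_le_mul_of_nonneg_left ((norm_increment_le h0 h1 _ _ _).trans ?_) h0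
  have a1 := norm_accel_sub_le L L₂ f φ h0 h1 t z w
  have a2 := norm_accel_sub_le L L₂ f φ h0 h1 (t + h) z' w'
  have a3 : ‖z.2 - w.2‖ ≤ ‖z - w‖ := norm_snd_le (z - w)
  unfold stepLipschitz
  rw [mul_assoc]
  refine mul_le_mul_of_nonneg_left ?_ (zero_le_one.trans (one_le_incrementBound β γ))
  have := norm_nonneg (z' - w')
  linarith

/-- For small step lengths the implicit step is a contraction in its unknown, so that it is
uniquely solvable. -/
theorem existsUnique_residual_eq_zero [CompleteSpace V] {h : ℝ} (h0 : 0 ≤ h) (h1 : h ≤ 1)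
    (hΛ : h * stepLipschitz L L₂ β γ ≤ 1 / 2) (t : ℝ) (z : V × V) :
    ∃! z', residual L L₂ f φ β γ h t z z' = 0 := by
  set T : V × V → V × V := fun z' => z' - residual L L₂ f φ β γ h t z z' with hT
  have hc : ContractingWith (1 / 2) T := by
    refine ⟨by norm_num [← NNReal.coe_lt_coe], LipschitzWith.of_dist_le_mul fun z' w' => ?_⟩
    rw [dist_eq_norm, dist_eq_norm]
    have := norm_residual_sub_le L L₂ f φ β γ h0 h1 t z z' z w'
    rw [sub_self, norm_zero, zero_add, sub_zero, ← norm_neg] at this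
    have e : T z' - T w' = -(residual L L₂ f φ β γ h t z z' - residual L L₂ f φ β γ h t z w'
      - (z' - w')) := by rw [hT]; module
    rw [e]
    refine this.trans (mul_le_mul_of_nonneg_right ?_ (norm_nonneg _))
    simpa using hΛ
  refine ⟨hc.fixedPoint, ?_, fun w hw => hc.fixedPoint_unique ?_⟩
  · have := hc.fixedPoint_isFixedPt
    simpa [Function.IsFixedPt, hT] using this
  · simp [Function.IsFixedPt, hT, hw]

/-- Stability of the step: the distance to a pair `(w, w')` that satisfies the step equations up to
a residual is amplified by `1 + O(h)` only. -/
theorem norm_sub_le_of_residual {h : ℝ} (h0 : 0 ≤ h) (h1 : h ≤ 1)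
    (hΛ : h * stepLipschitz L L₂ β γ ≤ 1 / 2) {t : ℝ} {z z' : V × V}
    (hz : residual L L₂ f φ β γ h t z z' = 0) (w w' : V × V) :
    ‖z' - w'‖ ≤ (1 + 4 * stepLipschitz L L₂ β γ * h) * ‖z - w‖ +
      2 * ‖residual L L₂ f φ β γ h t w w'‖ := by
  have h2 := norm_residual_sub_le L L₂ f φ β γ h0 h1 t z z' w w'
  rw [hz, zero_sub] at h2
  set r := residual L L₂ f φ β γ h t w w'
  have h3 : ‖z' - w'‖ ≤ ‖-r - ((z' - w') - (z - w))‖ + ‖z - w‖ + ‖r‖ := by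
    have e : z' - w' = -(-r - ((z' - w') - (z - w))) + (z - w) + -r := by module
    calc ‖z' - w'‖ = ‖-(-r - ((z' - w') - (z - w))) + (z - w) + -r‖ := by rw [← e]
      _ ≤ _ := by simpa only [norm_neg] using
        norm_add₃_le (a := -(-r - ((z' - w') - (z - w)))) (b := z - w) (c := -r)
  have n1 := norm_nonneg (z - w)
  have n2 := norm_nonneg (z' - w')
  have n3 := norm_nonneg r
  set x := h * stepLipschitz L L₂ β γ with hx
  have x0 : 0 ≤ x := mul_nonneg h0 (zero_le_one.trans (one_le_stepLipschitz L L₂ β γ))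
  -- `(1 + x) / (1 - x) ≤ 1 + 4 x` and `1 / (1 - x) ≤ 2` for `0 ≤ x ≤ 1 / 2`
  have h4 : (1 - x) * ‖z' - w'‖ ≤ (1 + x) * ‖z - w‖ + ‖r‖ := by nlinarith
  have h5 : (1 - x) * ‖z' - w'‖ ≤ (1 - x) * ((1 + 4 * x) * ‖z - w‖ + 2 * ‖r‖) := by
    refine h4.trans ?_
    nlinarith [mul_nonneg (mul_nonneg x0 (by linarith : 0 ≤ 1 - 2 * x)) n1,
      mul_nonneg (by linarith : 0 ≤ 1 - 2 * x) n3]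
  have h6 := le_of_mul_le_mul_left h5 (by linarith)
  rwa [show 4 * stepLipschitz L L₂ β γ * h = 4 * x by rw [hx]; ring]

/-- A pair close to an exact step has a small residual. -/
theorem norm_residual_le {h : ℝ} (h0 : 0 ≤ h) (h1 : h ≤ 1)
    (hΛ : h * stepLipschitz L L₂ β γ ≤ 1 / 2) {t : ℝ} {z z' : V × V}
    (hz : residual L L₂ f φ β γ h t z z' = 0) (w w' : V × V) :
    ‖residual L L₂ f φ β γ h t w w'‖ ≤ 2 * (‖z - w‖ + ‖z' - w'‖) := by
  have h2 := norm_residual_sub_le L L₂ f φ β γ h0 h1 t z z' w w'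
  rw [hz, zero_sub] at h2
  set r := residual L L₂ f φ β γ h t w w'
  have e : r = -(-r - ((z' - w') - (z - w))) + (z - w) - (z' - w') := by module
  have h3 : ‖r‖ ≤ ‖-r - ((z' - w') - (z - w))‖ + ‖z - w‖ + ‖z' - w'‖ := by
    calc ‖r‖ = ‖-(-r - ((z' - w') - (z - w))) + (z - w) - (z' - w')‖ := by rw [← e]
      _ ≤ ‖-(-r - ((z' - w') - (z - w))) + (z - w)‖ + ‖z' - w'‖ := norm_sub_le _ _
      _ ≤ _ := by
        gcongr
        simpa only [norm_neg] using norm_add_le (-(-r - ((z' - w') - (z - w)))) (z - w)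
  have n1 := norm_nonneg (z - w)
  have n2 := norm_nonneg (z' - w')
  nlinarith

end Residual

/-! ### Taylor expansion and the residual of smooth curves -/

section Taylor

variable {V : Type*} [NormedAddCommGroup V] [NormedSpace ℝ V]

theorem norm_sub_taylor_le (m : ℕ) {u : ℕ → ℝ → V} {t h B : ℝ} (h0 : 0 ≤ h)
    (hu : ∀ k < m, ∀ s, HasDerivAt (u k) (u (k + 1) s) s)
    (hB : ∀ s ∈ Set.Icc t (t + h), ‖u m s‖ ≤ B) :
    ‖u 0 (t + h) - ∑ k ∈ Finset.range m, (h ^ k / (k.factorial : ℝ)) • u k t‖ ≤ B * h ^ m := by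
  induction m generalizing u h with
  | zero => simpa using hB (t + h) ⟨by linarith, le_rfl⟩
  | succ m ih =>
    have hd : ∀ s, HasDerivAt
        (fun s => u 0 s - ∑ k ∈ Finset.range (m + 1),
          ((s - t) ^ k / (k.factorial : ℝ)) • u k t)
        (u 1 s - ∑ k ∈ Finset.range m, ((s - t) ^ k / (k.factorial : ℝ)) • u (k + 1) t) s := by
      intro s
      simp only [Finset.sum_range_succ' _ m]
      refine (hu 0 (Nat.succ_pos m) s).sub ?_
      simp only [pow_zero]
      refine HasDerivAt.add_const _ (HasDerivAt.fun_sum fun k _ => ?_)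
      have h1 : HasDerivAt (fun s : ℝ => (s - t) ^ (k + 1) / ((k + 1).factorial : ℝ))
          ((s - t) ^ k / (k.factorial : ℝ)) s := by
        have := (((hasDerivAt_id s).sub_const t).pow (k + 1)).div_const ((k + 1).factorial : ℝ)
        refine this.congr_deriv ?_
        rw [Nat.factorial_succ]
        push_cast
        have : (k.factorial : ℝ) ≠ 0 := by positivity
        have : (k : ℝ) + 1 ≠ 0 := by positivity
        simp
        field_simp
      exact h1.smul_const _
    have hb : 0 ≤ B := (norm_nonneg _).trans (hB t ⟨le_rfl, by linarith⟩)
    have key := norm_image_sub_le_of_norm_deriv_le_segment' (a := t) (b := t + h) (C := B * h ^ m)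
      (fun s _ => (hd s).hasDerivWithinAt) (fun s hs => ?_) (t + h) ⟨by linarith, le_rfl⟩
    · have z : u 0 t - ∑ k ∈ Finset.range (m + 1),
          ((t - t) ^ k / (k.factorial : ℝ)) • u k t = 0 := by
        simp [Finset.sum_range_succ']
      simp only [z, sub_zero, add_sub_cancel_left] at key
      calc _ ≤ _ := key
        _ = _ := by ring
    · have := ih (u := fun k => u (k + 1)) (h := s - t) (by linarith [hs.1])
        (fun k hk => hu (k + 1) (by omega))
        (fun r hr => hB r ⟨hr.1, by linarith [hr.2, hs.2]⟩)
      rw [show t + (s - t) = s by ring] at this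
      refine this.trans (mul_le_mul_of_nonneg_left ?_ hb)
      exact pow_le_pow_left₀ (by linarith [hs.1]) (by linarith [hs.2]) m

theorem norm_smul_le_of_le {c d : ℝ} {x : V} {b : ℝ} (hc : |c| ≤ d) (hx : ‖x‖ ≤ b) :
    ‖c • x‖ ≤ d * b := by
  rw [norm_smul, Real.norm_eq_abs]
  exact mul_le_mul hc hx (norm_nonneg _) ((abs_nonneg c).trans hc)

/-- With accelerations corrected by `-h² / 12` times their second derivative, the scheme with
`β = 1 / 6`, `γ = 1 / 2` integrates smooth curves up to `O(h ^ 5)`. -/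
theorem norm_fifth_order_defect_le {u : ℕ → ℝ → V} {t h B : ℝ} (h0 : 0 ≤ h)
    (hu : ∀ k < 6, ∀ s, HasDerivAt (u k) (u (k + 1) s) s)
    (hB : ∀ k ≤ 6, ∀ s ∈ Set.Icc t (t + h), ‖u k s‖ ≤ B) :
    ‖(u 0 (t + h), u 1 (t + h)) - (u 0 t, u 1 t) - h • increment (1 / 6) (1 / 2) h (u 1 t)
      (u 2 t + h ^ 2 • (-(1 / 12 : ℝ) • u 4 t))
      (u 2 (t + h) + h ^ 2 • (-(1 / 12 : ℝ) • u 4 (t + h)))‖ ≤ 2 * B * h ^ 5 := by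
  have tay : ∀ i m, i + m ≤ 6 → ‖u i (t + h) - ∑ k ∈ Finset.range m,
      (h ^ k / (k.factorial : ℝ)) • u (i + k) t‖ ≤ B * h ^ m := fun i m him => by
    refine norm_sub_taylor_le (u := fun k => u (i + k)) m h0
      (fun k hk => hu (i + k) (by omega)) (fun s hs => hB (i + m) him s hs)
  have hb : 0 ≤ B := (norm_nonneg _).trans (hB 0 (by norm_num) t ⟨le_rfl, by linarith⟩)
  have hh : 0 ≤ B * h ^ 5 := by positivity
  refine norm_prod_le_iff.2 ⟨?_, ?_⟩
  · have r0 := tay 0 5 (by norm_num)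
    have r2 := norm_smul_le_of_le (c := -(h ^ 2 / 6)) (d := h ^ 2 / 6)
      (by rw [abs_neg, abs_of_nonneg (by positivity)]) (tay 2 3 (by norm_num))
    have r4 := norm_smul_le_of_le (c := h ^ 4 / 72) (d := h ^ 4 / 72)
      (by rw [abs_of_nonneg (by positivity)]) (tay 4 1 (by norm_num))
    have tri := (norm_add₃_le).trans (add_le_add (add_le_add r0 r2) r4)
    have : h ^ 2 / 6 * (B * h ^ 3) = B * h ^ 5 / 6 := by ring
    have : h ^ 4 / 72 * (B * h ^ 1) = B * h ^ 5 / 72 := by ring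
    refine le_trans (le_of_eq ?_) (tri.trans (by linarith))
    congr 1
    simp only [increment, Finset.sum_range_succ, Finset.sum_range_zero, Nat.factorial,
      Prod.fst_sub, Prod.smul_fst]
    push_cast
    norm_num only [Nat.reduceAdd]
    module
  · have r0 := tay 1 5 (by norm_num)
    have r2 := norm_smul_le_of_le (c := -(h / 2)) (d := h / 2)
      (by rw [abs_neg, abs_of_nonneg (by positivity)]) (tay 2 4 (by norm_num))
    have r4 := norm_smul_le_of_le (c := h ^ 3 / 24) (d := h ^ 3 / 24)
      (by rw [abs_of_nonneg (by positivity)]) (tay 4 2 (by norm_num))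
    have tri := (norm_add₃_le).trans (add_le_add (add_le_add r0 r2) r4)
    have : h / 2 * (B * h ^ 4) = B * h ^ 5 / 2 := by ring
    have : h ^ 3 / 24 * (B * h ^ 2) = B * h ^ 5 / 24 := by ring
    refine le_trans (le_of_eq ?_) (tri.trans (by linarith))
    congr 1
    simp only [increment, Finset.sum_range_succ, Finset.sum_range_zero, Nat.factorial,
      Prod.snd_sub, Prod.smul_snd]
    push_cast
    norm_num only [Nat.reduceAdd]
    module

/-- The leading term of the position component of the residual: whatever correction `w` of order
`h²` is added to the accelerations, it is `h³ (1 / 6 - β)` times the third derivative. -/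
theorem norm_position_defect_le {u : ℕ → ℝ → V} {w : ℝ → V} {t h B W : ℝ} (β γ : ℝ) (h0 : 0 ≤ h)
    (hu : ∀ k < 4, ∀ s, HasDerivAt (u k) (u (k + 1) s) s)
    (hB : ∀ s ∈ Set.Icc t (t + h), ‖u 4 s‖ ≤ B) (hW : ∀ s ∈ Set.Icc t (t + h), ‖w s‖ ≤ W) :
    ‖((u 0 (t + h), u 1 (t + h)) - (u 0 t, u 1 t) - h • increment β γ h (u 1 t)
      (u 2 t + h ^ 2 • w t) (u 2 (t + h) + h ^ 2 • w (t + h))).1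
        - (h ^ 3 * (1 / 6 - β)) • u 3 t‖ ≤
      ((1 + |β|) * B + (|1 - 2 * β| + |2 * β|) * W) * h ^ 4 := by
  have r0 := norm_sub_taylor_le 4 h0 hu hB
  have r2 := norm_smul_le_of_le (c := -(h ^ 2 * β)) (d := h ^ 2 * |β|)
    (by rw [abs_neg, abs_mul, abs_of_nonneg (by positivity : 0 ≤ h ^ 2)])
    (norm_sub_taylor_le (u := fun k => u (2 + k)) 2 h0
      (fun k hk => hu (2 + k) (by omega)) (fun s hs => hB s hs))
  have w0 := norm_smul_le_of_le (c := -(h ^ 4 / 2) * (1 - 2 * β)) (d := h ^ 4 / 2 * |1 - 2 * β|)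
    (by rw [abs_mul, abs_neg, abs_of_nonneg (by positivity : 0 ≤ h ^ 4 / 2)])
    (hW t ⟨le_rfl, by linarith⟩)
  have w1 := norm_smul_le_of_le (c := -(h ^ 4 / 2) * (2 * β)) (d := h ^ 4 / 2 * |2 * β|)
    (by rw [abs_mul, abs_neg, abs_of_nonneg (by positivity : 0 ≤ h ^ 4 / 2)])
    (hW (t + h) ⟨by linarith, le_rfl⟩)
  have hw : 0 ≤ W := (norm_nonneg _).trans (hW t ⟨le_rfl, by linarith⟩)
  have p1 : 0 ≤ |1 - 2 * β| * W * h ^ 4 := by positivity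
  have p2 : 0 ≤ |2 * β| * W * h ^ 4 := by positivity
  have tri := (norm_add₄_le).trans (add_le_add (add_le_add (add_le_add r0 r2) w0) w1)
  refine le_trans (le_of_eq ?_) (tri.trans (by linarith))
  congr 1
  simp only [increment, Finset.sum_range_succ, Finset.sum_range_zero, Nat.factorial,
    Prod.fst_sub, Prod.smul_fst]
  push_cast
  norm_num only [Nat.reduceAdd]
  module

end Taylor

/-! ### Exact trajectories -/

section Linear

variable {E : Type*} [NormedAddCommGroup E] [NormedSpace ℝ E] [CompleteSpace E]

/-- Global solvability of inhomogeneous linear equations, by variation of constants. -/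
theorem exists_linear_ode_solution (B : E →L[ℝ] E) {ψ : ℝ → E} (hψ : Continuous ψ) (t₀ : ℝ)
    (z₀ : E) : ∃ Z : ℝ → E, Z t₀ = z₀ ∧ ∀ t, HasDerivAt Z (ψ t + B (Z t)) t := by
  let _ : NormedAlgebra ℚ (E →L[ℝ] E) := NormedAlgebra.restrictScalars ℚ ℝ _
  have hinv : ∀ t : ℝ, NormedSpace.exp (t • B) * NormedSpace.exp (-(t • B)) = 1 := fun t => by
    rw [← NormedSpace.exp_add_of_commute (Commute.refl _).neg_right, add_neg_cancel,
      NormedSpace.exp_zero]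
  have hinv0 : NormedSpace.exp ((0 : ℝ) • B) = 1 := by rw [zero_smul, NormedSpace.exp_zero]
  have hd : ∀ t : ℝ, HasDerivAt (fun u : ℝ => NormedSpace.exp (u • B))
      (B * NormedSpace.exp (t • B)) t := fun t => hasDerivAt_exp_smul_const' B t
  have hcont : Continuous fun s : ℝ => NormedSpace.exp (-(s • B)) (ψ s) := by
    have h1 : Continuous fun s : ℝ => NormedSpace.exp (-(s • B)) := by
      have h2 : Continuous fun u : ℝ => NormedSpace.exp (u • B) :=
        continuous_iff_continuousAt.2 fun t => (hd t).continuousAt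
      simpa only [neg_smul, Function.comp_def] using h2.comp continuous_neg
    exact h1.clm_apply hψ
  refine ⟨fun t => NormedSpace.exp (t • B) (NormedSpace.exp (-(t₀ • B)) z₀ +
    ∫ s in t₀..t, NormedSpace.exp (-(s • B)) (ψ s)), ?_, fun t => ?_⟩
  · simp only [intervalIntegral.integral_same, add_zero]
    rw [← mul_apply_eq_comp, hinv, one_apply_eq_self]
  · have h1 := (intervalIntegral.integral_hasDerivAt_right (hcont.intervalIntegrable t₀ t)
      (hcont.stronglyMeasurableAtFilter _ _) hcont.continuousAt).const_add (NormedSpace.exp (-(t₀ • B)) z₀)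
    refine ((hd t).clm_apply h1).congr_deriv ?_
    rw [mul_apply_eq_comp, ← mul_apply_eq_comp (NormedSpace.exp (t • B)),
      hinv, one_apply_eq_self, add_comm]

end Linear

section Trajectory

variable {V : Type*} [NormedAddCommGroup V] [NormedSpace ℝ V]

/-- `Z = (q, v)` solves `q' = v`, `v' = f + L (q, v)` on the whole time axis. -/
def IsTrajectory (L : V × V →L[ℝ] V) (f : ℝ → V) (Z : ℝ → V × V) : Prop :=
  ∀ t, HasDerivAt Z ((Z t).2, f t + L (Z t)) t

theorem exists_isTrajectory [CompleteSpace V] (L : V × V →L[ℝ] V) {f : ℝ → V} (hf : Continuous f)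
    (t₀ : ℝ) (z₀ : V × V) : ∃ Z, IsTrajectory L f Z ∧ Z t₀ = z₀ := by
  obtain ⟨Z, h0, hZ⟩ := exists_linear_ode_solution ((ContinuousLinearMap.snd ℝ V V).prod L)
    (ψ := fun t => ((0 : V), f t)) (by fun_prop) t₀ z₀
  exact ⟨Z, fun t => (hZ t).congr_deriv (by simp), h0⟩

theorem IsTrajectory.continuous {L : V × V →L[ℝ] V} {f : ℝ → V} {Z : ℝ → V × V}
    (hZ : IsTrajectory L f Z) : Continuous Z :=
  continuous_iff_continuousAt.2 fun t => (hZ t).continuousAt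

/-- A one-sided solution on `[0, b]`, started at time `τ` on a trajectory, stays on it. -/
theorem IsTrajectory.eq_of_hasDerivWithinAt {L : V × V →L[ℝ] V} {f : ℝ → V} {Z : ℝ → V × V}
    (hZ : IsTrajectory L f Z) {τ b : ℝ} {z : ℝ → V × V} (h0 : z 0 = Z τ)
    (hz : ∀ t ∈ Set.Icc 0 b, HasDerivWithinAt z ((z t).2, f (τ + t) + L (z t)) (Set.Icc 0 b) t)
    {t : ℝ} (ht : t ∈ Set.Icc 0 b) : z t = Z (τ + t) := by
  set B : V × V →L[ℝ] V × V := (ContinuousLinearMap.snd ℝ V V).prod L with hB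
  have hd : ∀ s, HasDerivAt (fun s => Z (τ + s)) ((0, f (τ + s)) + B (Z (τ + s))) s := fun s => by
    have := (hZ (τ + s)).comp_const_add τ s
    exact this.congr_deriv (by simp [hB])
  refine ODE_solution_unique (v := fun t z => ((0 : V), f (τ + t)) + B z) (K := ‖B‖₊)
    (fun t => ?_) (fun s hs => (hz s hs).continuousWithinAt) (fun s hs => ?_)
    (fun s _ => (hd s).continuousAt.continuousWithinAt) (fun s _ => (hd s).hasDerivWithinAt)
    (by simpa using h0) ht
  · refine LipschitzWith.of_dist_le_mul fun x y => ?_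
    rw [dist_add_left]
    exact B.lipschitz.dist_le_mul x y
  · have := (hz s ⟨hs.1, hs.2.le⟩).mono_of_mem_nhdsWithin (Icc_mem_nhdsGE_of_mem hs)
    exact this.congr_deriv (by simp [hB])

/-- Trajectories that start in a bounded set during a bounded time interval remain bounded over
one unit of time. -/
theorem exists_norm_trajectory_le (L : V × V →L[ℝ] V) {f : ℝ → V} (hf : Continuous f)
    (a b R : ℝ) : ∃ R' : ℝ, ∀ Z, IsTrajectory L f Z → ∀ τ ∈ Set.Icc a b, ‖Z τ‖ ≤ R →
      ∀ s ∈ Set.Icc τ (τ + 1), ‖Z s‖ ≤ R' := by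
  obtain ⟨Φ, hΦ⟩ := (isCompact_Icc (a := a) (b := b + 1)).exists_bound_of_continuousOn
    hf.continuousOn
  refine ⟨gronwallBound |R| (1 + ‖L‖) |Φ| 1, fun Z hZ τ hτ hR s hs => ?_⟩
  have key := norm_le_gronwallBound_of_norm_deriv_right_le (a := τ) (b := τ + 1) (δ := |R|)
    (K := 1 + ‖L‖) (ε := |Φ|) hZ.continuous.continuousOn (fun x _ => (hZ x).hasDerivWithinAt)
    (hR.trans (le_abs_self R)) (fun x hx => ?_) s hs
  · refine key.trans (gronwallBound_mono (abs_nonneg _) (abs_nonneg _) (by positivity) ?_)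
    linarith [hs.2]
  · have h1 : ‖f x‖ ≤ |Φ| :=
      (hΦ x ⟨hτ.1.trans hx.1, by linarith [hx.2, hτ.2]⟩).trans (le_abs_self _)
    have h2 := L.le_opNorm (Z x)
    have h3 : ‖(Z x).2‖ ≤ ‖Z x‖ := norm_snd_le _
    have h4 := norm_nonneg (Z x)
    have h5 := norm_nonneg L
    refine norm_prod_le_iff.2 ⟨?_, (norm_add_le _ _).trans ?_⟩
    · have := abs_nonneg Φ
      have := mul_nonneg h5 h4
      dsimp only
      linarith
    · linarith

/-- The derivatives of the position `q` along the trajectory through `z = (q, v)` at time `t`, as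
functions of `(t, z)`, obtained by differentiating `q'' = f + L (q, q')`. -/
noncomputable def jet (L : V × V →L[ℝ] V) (f : ℝ → V) (t : ℝ) (z : V × V) : ℕ → V
  | 0 => z.1
  | 1 => z.2
  | k + 2 => iteratedDeriv k f t + L (jet L f t z k, jet L f t z (k + 1))

theorem IsTrajectory.hasDerivAt_jet {L : V × V →L[ℝ] V} {f : ℝ → V} (hf : ContDiff ℝ 4 f)
    {Z : ℝ → V × V} (hZ : IsTrajectory L f Z) (t : ℝ) : ∀ k < 6,
      HasDerivAt (fun s => jet L f s (Z s) k) (jet L f t (Z t) (k + 1)) t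
  | 0, _ => (ContinuousLinearMap.fst ℝ V V).hasFDerivAt.comp_hasDerivAt t (hZ t)
  | 1, _ => by
    refine ((ContinuousLinearMap.snd ℝ V V).hasFDerivAt.comp_hasDerivAt t (hZ t)).congr_deriv ?_
    simp [jet]
  | k + 2, hk => by
    have h1 := hZ.hasDerivAt_jet hf t k (by omega)
    have h2 := hZ.hasDerivAt_jet hf t (k + 1) (by omega)
    have h3 : HasDerivAt (iteratedDeriv k f) (iteratedDeriv (k + 1) f t) t := by
      rw [iteratedDeriv_succ]
      refine (hf.differentiable_iteratedDeriv k ?_ t).hasDerivAt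
      exact_mod_cast (by omega : k < 4)
    exact h3.add (L.hasFDerivAt.comp_hasDerivAt t (h1.prodMk h2))

theorem exists_norm_jet_le (L : V × V →L[ℝ] V) {f : ℝ → V} (hf : ContDiff ℝ 4 f) (a b R : ℝ) :
    ∃ B : ℝ, 0 ≤ B ∧ ∀ t ∈ Set.Icc a b, ∀ z, ‖z‖ ≤ R → ∀ k ≤ 6, ‖jet L f t z k‖ ≤ B := by
  have one : ∀ k : ℕ, ∃ B : ℝ, k ≤ 6 → ∀ t ∈ Set.Icc a b, ∀ z, ‖z‖ ≤ R → ‖jet L f t z k‖ ≤ B := by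
    intro k
    induction k using Nat.strong_induction_on with
    | _ k ih =>
      match k, ih with
      | 0, _ => exact ⟨R, fun _ t _ z hz => (norm_fst_le z).trans hz⟩
      | 1, _ => exact ⟨R, fun _ t _ z hz => (norm_snd_le z).trans hz⟩
      | k + 2, ih =>
        obtain ⟨B₀, h0⟩ := ih k (by omega)
        obtain ⟨B₁, h1⟩ := ih (k + 1) (by omega)
        by_cases hk : k ≤ 4
        · obtain ⟨Φ, hΦ⟩ := (isCompact_Icc (a := a) (b := b)).exists_bound_of_continuousOn
            (hf.continuous_iteratedDeriv k (by exact_mod_cast hk)).continuousOn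
          refine ⟨Φ + ‖L‖ * max B₀ B₁, fun _ t ht z hz => ?_⟩
          refine (norm_add_le _ _).trans (add_le_add (hΦ t ht) ((L.le_opNorm _).trans ?_))
          exact mul_le_mul_of_nonneg_left (max_le_max (h0 (by omega) t ht z hz)
            (h1 (by omega) t ht z hz)) (norm_nonneg L)
        · exact ⟨0, fun h => by omega⟩
  choose B hB using one
  refine ⟨∑ k ∈ Finset.range 7, |B k|, Finset.sum_nonneg fun _ _ => abs_nonneg _,
    fun t ht z hz k hk => ?_⟩
  refine (hB k hk t ht z hz).trans ((le_abs_self _).trans ?_)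
  exact Finset.single_le_sum (f := fun k => |B k|) (fun _ _ => abs_nonneg _)
    (Finset.mem_range.2 (by omega))

theorem accel_eq_jet (L L₂ : V × V →L[ℝ] V) (f φ : ℝ → V) (h t : ℝ) (z : V × V) :
    accel L L₂ f φ h t z = jet L f t z 2 + h ^ 2 • (φ t + L₂ z) := by
  simp [accel, jet]

/-- The local error of the scheme whose compensation is `-1 / 12` times the second derivative of
the acceleration. -/
theorem IsTrajectory.norm_residual_le {L L₂ : V × V →L[ℝ] V} {f φ : ℝ → V} (hf : ContDiff ℝ 4 f)
    (hφ : ∀ t z, φ t + L₂ z = -(1 / 12 : ℝ) • jet L f t z 4) {Z : ℝ → V × V}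
    (hZ : IsTrajectory L f Z) {t h B : ℝ} (h0 : 0 ≤ h)
    (hB : ∀ s ∈ Set.Icc t (t + h), ∀ k ≤ 6, ‖jet L f s (Z s) k‖ ≤ B) :
    ‖residual L L₂ f φ (1 / 6) (1 / 2) h t (Z t) (Z (t + h))‖ ≤ 2 * B * h ^ 5 := by
  have := norm_fifth_order_defect_le (u := fun k s => jet L f s (Z s) k) (t := t) (B := B) h0
    (fun k hk s => hZ.hasDerivAt_jet hf s k hk) (fun k hk s hs => hB s hs k hk)
  simp only [residual, accel_eq_jet, hφ]
  exact this

/-- If the residual of a trajectory is `O(h ^ 4)` at a point where the third derivative of the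
position does not vanish, then `β = 1 / 6`. -/
theorem IsTrajectory.beta_eq {L L₂ : V × V →L[ℝ] V} {f φ : ℝ → V} (hf : ContDiff ℝ 4 f)
    (hφ : Continuous φ) {Z : ℝ → V × V} (hZ : IsTrajectory L f Z) {τ β γ C : ℝ}
    (hA : jet L f τ (Z τ) 3 ≠ 0)
    (hC : ∀ ε > 0, ∃ h, 0 < h ∧ h < ε ∧
      ‖residual L L₂ f φ β γ h τ (Z τ) (Z (τ + h))‖ ≤ C * h ^ 4) : β = 1 / 6 := by
  have c4 : Continuous fun s => jet L f s (Z s) 4 :=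
    continuous_iff_continuousAt.2 fun s => (hZ.hasDerivAt_jet hf s 4 (by norm_num)).continuousAt
  have cw : Continuous fun s => φ s + L₂ (Z s) := hφ.add (L₂.continuous.comp hZ.continuous)
  obtain ⟨B, hB⟩ := (isCompact_Icc (a := τ) (b := τ + 1)).exists_bound_of_continuousOn
    c4.continuousOn
  obtain ⟨W, hW⟩ := (isCompact_Icc (a := τ) (b := τ + 1)).exists_bound_of_continuousOn
    cw.continuousOn
  set D := C + ((1 + |β|) * B + (|1 - 2 * β| + |2 * β|) * W) with hD
  have small : ∀ ε > 0, ∃ h, 0 < h ∧ h < ε ∧ ‖(1 / 6 - β) • jet L f τ (Z τ) 3‖ ≤ D * h := by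
    intro ε hε
    obtain ⟨h, h0, h1, hres⟩ := hC (min ε 1) (lt_min hε one_pos)
    refine ⟨h, h0, h1.trans_le (min_le_left _ _), ?_⟩
    have hle : h ≤ 1 := (h1.trans_le (min_le_right _ _)).le
    have key := norm_position_defect_le (u := fun k s => jet L f s (Z s) k)
      (w := fun s => φ s + L₂ (Z s)) (t := τ) β γ h0.le
      (fun k hk s => hZ.hasDerivAt_jet hf s k (by omega))
      (fun s hs => hB s ⟨hs.1, hs.2.trans (by linarith)⟩)
      (fun s hs => hW s ⟨hs.1, hs.2.trans (by linarith)⟩)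
    have hr : ‖(residual L L₂ f φ β γ h τ (Z τ) (Z (τ + h))).1‖ ≤ C * h ^ 4 :=
      (norm_fst_le _).trans hres
    simp only [residual, accel_eq_jet] at hr
    have h3 : ‖(h ^ 3 * (1 / 6 - β)) • jet L f τ (Z τ) 3‖ ≤ D * h ^ 4 := by
      have := (norm_le_norm_add_norm_sub _ _).trans (add_le_add hr key)
      rw [hD]
      linarith
    rw [mul_smul, norm_smul, Real.norm_eq_abs, abs_of_pos (by positivity : 0 < h ^ 3)] at h3
    have h4 : 0 < h ^ 3 := by positivity
    nlinarith
  have hzero : ‖(1 / 6 - β) • jet L f τ (Z τ) 3‖ = 0 := by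
    by_contra hne
    have hpos := lt_of_le_of_ne (norm_nonneg _) (Ne.symm hne)
    obtain ⟨h, h0, h1, h2⟩ := small (‖(1 / 6 - β) • jet L f τ (Z τ) 3‖ / (|D| + 1))
      (by positivity)
    rw [lt_div_iff₀ (by positivity)] at h1
    nlinarith [le_abs_self D]
  rcases smul_eq_zero.1 (norm_eq_zero.1 hzero) with h | h
  · linarith
  · exact absurd h hA

end Trajectory

/-! ### Uniqueness of the coefficients of a distorted vector field -/

section Distorted

variable {X : Type*} [NormedAddCommGroup X] [NormedSpace ℝ X]

/-- A curve whose speed is at most `B` as long as it stays in the ball of radius `δ` cannot leave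
that ball before the time `δ / (B + 1)`. -/
theorem norm_sub_le_of_norm_deriv_le_in_ball {y y' : ℝ → X} {x : X} {h δ B : ℝ} (hB : 0 ≤ B)
    (h0 : y 0 = x) (hy : ∀ t ∈ Set.Icc 0 h, HasDerivWithinAt y (y' t) (Set.Icc 0 h) t)
    (hy' : ∀ t ∈ Set.Icc 0 h, ‖y t - x‖ ≤ δ → ‖y' t‖ ≤ B) (hh : (B + 1) * h ≤ δ)
    {t : ℝ} (ht : t ∈ Set.Icc 0 h) : ‖y t - x‖ ≤ δ := by
  have key := image_norm_le_of_norm_deriv_right_lt_deriv_boundary' (f := fun t => y t - x)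
    (f' := y') (a := 0) (b := h) (B := fun t => (B + 1) * t) (B' := fun _ => B + 1)
    (fun t ht => ((hy t ht).continuousWithinAt).sub continuousWithinAt_const)
    (fun s hs => ((hy s ⟨hs.1, hs.2.le⟩).mono_of_mem_nhdsWithin
      (Icc_mem_nhdsGE_of_mem hs)).sub_const x) (by simp [h0]) (by fun_prop)
    (fun s _ => by simpa using ((hasDerivAt_id s).const_mul (B + 1)).hasDerivWithinAt)
    (fun s hs hs' => ?_) ht
  · exact key.trans ((mul_le_mul_of_nonneg_left ht.2 (by linarith)).trans hh)
  · have : ‖y s - x‖ ≤ δ := by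
      rw [hs']
      exact (mul_le_mul_of_nonneg_left hs.2.le (by linarith)).trans hh
    linarith [hy' s ⟨hs.1, hs.2.le⟩ this]

/-- Two families of flows that agree up to `O(h ^ (p + 1))` after time `h` and whose first `m < p`
coefficients agree have the same coefficient number `m`: the flows differ by `h ^ (m + 1)` times
the difference of these coefficients, up to `o(h ^ (m + 1))`. -/
theorem coefficient_eq_of_flows_close {p m : ℕ} (hm : m < p) {g g' : ℕ → X → X}
    (hg : ∀ k < p, ContDiff ℝ 1 (g k)) (hg' : ∀ k < p, ContDiff ℝ 1 (g' k))
    (heq : ∀ k < m, g k = g' k) (x : X) {c h₀ : ℝ} (hc : 0 < c) (hh₀ : 0 < h₀)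
    (hflow : ∀ h, 0 < h → h ≤ h₀ → ∃ y y' : ℝ → X, y 0 = x ∧ y' 0 = x ∧
      (∀ t ∈ Set.Icc 0 h, HasDerivWithinAt y (∑ k ∈ Finset.range p, h ^ k • g k (y t))
        (Set.Icc 0 h) t) ∧
      (∀ t ∈ Set.Icc 0 h, HasDerivWithinAt y' (∑ k ∈ Finset.range p, h ^ k • g' k (y' t))
        (Set.Icc 0 h) t) ∧ ‖y h - y' h‖ ≤ c * h ^ (p + 1)) :
    g m x = g' m x := by
  set P : ℝ × X → X := fun w => ∑ k ∈ Finset.range p, w.1 ^ k • g k w.2 with hP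
  set Q : ℝ × X → X := fun w => ∑ k ∈ Finset.range p, w.1 ^ k • g' k w.2 with hQ
  set R : ℝ × X → X := fun w => ∑ k ∈ Finset.range p, w.1 ^ (k - m) • (g k w.2 - g' k w.2) with hR
  have cP : Continuous P := continuous_finsetSum _ fun k hk =>
    (continuous_fst.pow k).smul ((hg k (Finset.mem_range.1 hk)).continuous.comp continuous_snd)
  have cQ : Continuous Q := continuous_finsetSum _ fun k hk =>
    (continuous_fst.pow k).smul ((hg' k (Finset.mem_range.1 hk)).continuous.comp continuous_snd)
  have dQ : ContDiff ℝ 1 Q := ContDiff.sum fun k hk =>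
    (contDiff_fst.pow k).smul ((hg' k (Finset.mem_range.1 hk)).comp contDiff_snd)
  have cR : Continuous R := continuous_finsetSum _ fun k hk =>
    (continuous_fst.pow (k - m)).smul
      (((hg k (Finset.mem_range.1 hk)).continuous.comp continuous_snd).sub
        ((hg' k (Finset.mem_range.1 hk)).continuous.comp continuous_snd))
  have hPQ : ∀ w, P w - Q w = w.1 ^ m • R w := fun w => by
    rw [hP, hQ, hR]
    simp only [← Finset.sum_sub_distrib, Finset.smul_sum, ← smul_sub, smul_smul]
    refine Finset.sum_congr rfl fun k _ => ?_
    by_cases hk : k < m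
    · simp [heq k hk]
    · rw [← pow_add, Nat.add_sub_cancel' (not_lt.1 hk)]
  set e := g m x - g' m x with he
  have hR0 : R (0, x) = e := by
    rw [hR]
    dsimp only
    rw [Finset.sum_eq_single_of_mem m (Finset.mem_range.2 hm) fun k _ hkm => ?_]
    · simp [he]
    · rcases lt_or_gt_of_ne hkm with h | h
      · simp [heq k h]
      · simp [Nat.sub_ne_zero_of_lt h]
  suffices hsmall : ∀ ε > 0, ‖e‖ ≤ ε + ε by
    have : ‖e‖ ≤ 0 := le_of_forall_pos_le_add fun ε hε => by
      linarith [hsmall (ε / 2) (by positivity)]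
    exact sub_eq_zero.1 (norm_le_zero_iff.1 this)
  intro ε hε
  obtain ⟨K, U, hU, hK⟩ := dQ.contDiffAt.exists_lipschitzOnWith (x := ((0 : ℝ), x))
  have hRε : ‖R (0, x) - e‖ < ε := by rwa [hR0, sub_self, norm_zero]
  have ev : ∀ᶠ w in nhds ((0 : ℝ), x), w ∈ U ∧ ‖P w‖ < ‖P (0, x)‖ + 1 ∧ ‖Q w‖ < ‖Q (0, x)‖ + 1 ∧
      ‖R w - e‖ < ε := by
    refine Filter.Eventually.and hU (Filter.Eventually.and ?_ (Filter.Eventually.and ?_ ?_))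
    · exact cP.norm.continuousAt.eventually_lt continuousAt_const (by simp)
    · exact cQ.norm.continuousAt.eventually_lt continuousAt_const (by simp)
    · exact (cR.sub continuous_const).norm.continuousAt.eventually_lt continuousAt_const
        hRε
  obtain ⟨δ, hδ, hball⟩ := Metric.nhds_basis_closedBall.eventually_iff.1 ev
  set B := max (‖P (0, x)‖ + 1) (‖Q (0, x)‖ + 1) with hB
  have hB0 : 0 ≤ B := le_max_of_le_left (by positivity)
  -- `S` collects the constants in front of the terms that are of higher order in `h`
  set S := c + 2 * K * (‖e‖ + ε) with hS
  have hS0 : 0 < S := by positivity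
  obtain ⟨h, hh, hh1⟩ : ∃ h : ℝ, 0 < h ∧ h ≤ min (min h₀ 1) (min (min δ (δ / (B + 1)))
      (min (1 / (2 * (K + 1))) (ε / S))) :=
    ⟨_, by positivity, le_rfl⟩
  simp only [le_min_iff] at hh1
  obtain ⟨⟨hhh₀, hh1⟩, ⟨hhδ, hhB⟩, hhK, hhS⟩ := hh1
  rw [le_div_iff₀ (by positivity)] at hhB hhK hhS
  obtain ⟨y, y', y0, y'0, dy, dy', hyy'⟩ := hflow h hh hhh₀
  have mem : ∀ z : X, ‖z - x‖ ≤ δ → (h, z) ∈ Metric.closedBall ((0 : ℝ), x) δ := fun z hz => by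
    rw [mem_closedBall_iff_norm]
    refine norm_prod_le_iff.2 ⟨?_, hz⟩
    simpa [abs_of_pos hh] using hhδ
  have inP : ∀ t ∈ Set.Icc 0 h, ‖y t - x‖ ≤ δ := fun t ht =>
    norm_sub_le_of_norm_deriv_le_in_ball hB0 y0 dy
      (fun s _ hs' => ((hball (mem _ hs')).2.1.le.trans (le_max_left _ _)))
      (by linarith) ht
  have inQ : ∀ t ∈ Set.Icc 0 h, ‖y' t - x‖ ≤ δ := fun t ht =>
    norm_sub_le_of_norm_deriv_le_in_ball hB0 y'0 dy'
      (fun s _ hs' => ((hball (mem _ hs')).2.2.1.le.trans (le_max_right _ _)))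
      (by linarith) ht
  have dD : ∀ t ∈ Set.Icc 0 h, HasDerivWithinAt (fun t => y t - y' t)
      (Q (h, y t) - Q (h, y' t) + h ^ m • R (h, y t)) (Set.Icc 0 h) t := fun t ht => by
    refine ((dy t ht).sub (dy' t ht)).congr_deriv ?_
    rw [← hPQ (h, y t)]
    simp only [hP, hQ]
    abel
  have lipQ : ∀ t ∈ Set.Icc 0 h, ‖Q (h, y t) - Q (h, y' t)‖ ≤ K * ‖y t - y' t‖ := fun t ht => by
    have := hK.norm_sub_le (hball (mem _ (inP t ht))).1 (hball (mem _ (inQ t ht))).1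
    simpa [Prod.norm_def] using this
  have bR : ∀ t ∈ Set.Icc 0 h, ‖R (h, y t) - e‖ ≤ ε := fun t ht =>
    (hball (mem _ (inP t ht))).2.2.2.le
  have hp : 0 < h ^ m := by positivity
  obtain ⟨s, hs, hmax⟩ := isCompact_Icc.exists_isMaxOn ⟨(0 : ℝ), le_rfl, hh.le⟩
    (fun t ht => (dD t ht).continuousWithinAt.norm)
  set μ := ‖y s - y' s‖ with hμ
  have bD : ∀ t ∈ Set.Icc 0 h, ‖y t - y' t‖ ≤ μ := fun t ht => hmax ht
  have b1 : μ ≤ (K * μ + h ^ m * (‖e‖ + ε)) * s := by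
    have := norm_image_sub_le_of_norm_deriv_le_segment' dD
      (C := K * μ + h ^ m * (‖e‖ + ε)) (fun t ht => ?_) s hs
    · simpa [y0, y'0] using this
    · have ht' : t ∈ Set.Icc 0 h := ⟨ht.1, ht.2.le⟩
      refine (norm_add_le _ _).trans (add_le_add ((lipQ t ht').trans ?_) ?_)
      · exact mul_le_mul_of_nonneg_left (bD t ht') K.coe_nonneg
      · rw [norm_smul, Real.norm_eq_abs, abs_of_pos hp]
        refine mul_le_mul_of_nonneg_left ?_ hp.le
        have := norm_add_le (R (h, y t) - e) e
        rw [sub_add_cancel] at this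
        linarith [bR t ht']
  have b2 : μ ≤ 2 * (h ^ m * (‖e‖ + ε)) * h := by
    have k0 := K.coe_nonneg
    have m0 : 0 ≤ μ := norm_nonneg _
    have e0 : 0 ≤ h ^ m * (‖e‖ + ε) := by positivity
    have := mul_le_mul_of_nonneg_left hs.2 (by positivity : 0 ≤ K * μ + h ^ m * (‖e‖ + ε))
    nlinarith
  have b3 : ‖(y h - y' h) - h • (h ^ m • e)‖ ≤ (K * μ + h ^ m * ε) * h := by
    have := norm_image_sub_le_of_norm_deriv_le_segment'
      (fun t ht => (dD t ht).sub ((hasDerivAt_id t).smul_const (h ^ m • e)).hasDerivWithinAt)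
      (C := K * μ + h ^ m * ε) (fun t ht => ?_) h ⟨hh.le, le_rfl⟩
    · simpa [y0, y'0] using this
    · have ht' : t ∈ Set.Icc 0 h := ⟨ht.1, ht.2.le⟩
      rw [one_smul, add_sub_assoc, ← smul_sub]
      refine (norm_add_le _ _).trans (add_le_add ((lipQ t ht').trans ?_) ?_)
      · exact mul_le_mul_of_nonneg_left (bD t ht') K.coe_nonneg
      · rw [norm_smul, Real.norm_eq_abs, abs_of_pos hp]
        exact mul_le_mul_of_nonneg_left (bR t ht') hp.le
  have b4 : c * h ^ (p + 1) ≤ c * h ^ (m + 2) :=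
    mul_le_mul_of_nonneg_left (pow_le_pow_of_le_one hh.le hh1 (by omega)) hc.le
  have b5 : h ^ (m + 1) * ‖e‖ ≤ h ^ (m + 1) * (ε + ε) := by
    have t1 : ‖h • (h ^ m • e)‖ = h ^ (m + 1) * ‖e‖ := by
      rw [smul_smul, norm_smul, Real.norm_eq_abs, abs_of_pos (by positivity), pow_succ, mul_comm h]
    have t2 := norm_le_norm_add_norm_sub (y h - y' h) (h • (h ^ m • e))
    rw [t1] at t2
    have t3 : (K * μ + h ^ m * ε) * h ≤ (K * (2 * (h ^ m * (‖e‖ + ε)) * h) + h ^ m * ε) * h := by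
      have := mul_le_mul_of_nonneg_left b2 K.coe_nonneg
      exact mul_le_mul_of_nonneg_right (by linarith) hh.le
    have t4 : c * h ^ (m + 2) + (K * (2 * (h ^ m * (‖e‖ + ε)) * h) + h ^ m * ε) * h =
        h ^ (m + 1) * (h * S + ε) := by rw [hS]; ring
    have t5 : h ^ (m + 1) * (h * S + ε) ≤ h ^ (m + 1) * (ε + ε) :=
      mul_le_mul_of_nonneg_left (by linarith) (by positivity)
    linarith
  exact le_of_mul_le_mul_left b5 (by positivity)

/-- The coefficients of the distorted vector field of a one-step method are unique. -/
theorem IsDistortedExpansion.unique {n p : ℕ} {S : ℝ → State n → State n → Prop}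
    {g g' : ℕ → State n → State n} (h : IsDistortedExpansion S p g)
    (h' : IsDistortedExpansion S p g') : ∀ k < p, g k = g' k := by
  intro k
  induction k using Nat.strong_induction_on with
  | _ k ih =>
    intro hk
    funext x
    obtain ⟨c, h₀, hc, hh₀, H⟩ := h.2 {x} isCompact_singleton
    obtain ⟨c', h₀', hc', hh₀', H'⟩ := h'.2 {x} isCompact_singleton
    refine coefficient_eq_of_flows_close hk h.1 h'.1 (fun j hj => ih j hj (hj.trans hk)) x
      (add_pos hc hc') (lt_min hh₀ hh₀') fun s hs hs' => ?_
    obtain ⟨z, y, hz, huniq, y0, dy, hy⟩ := H s hs (hs'.trans (min_le_left _ _)) x rfl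
    obtain ⟨z', y', hz', -, y0', dy', hy'⟩ := H' s hs (hs'.trans (min_le_right _ _)) x rfl
    refine ⟨y, y', y0, y0', dy, dy', ?_⟩
    rw [huniq z' hz'] at hy'
    rw [norm_sub_rev] at hy
    linarith [norm_sub_le_norm_sub_add_norm_sub (y s) z (y' s)]

end Distorted

/-! ### The mechanical system in normalized form -/

section System

variable {n : ℕ}

/-- The part `-M⁻¹ (C v + K q)` of the acceleration that is linear in the state `(q, v)`. -/
noncomputable def linearAccel (M C K : Matrix (Fin n) (Fin n) ℝ) :
    (Fin n → ℝ) × (Fin n → ℝ) →L[ℝ] (Fin n → ℝ) :=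
  LinearMap.toContinuousLinearMap
    (-(M⁻¹.mulVecLin ∘ₗ (C.mulVecLin ∘ₗ LinearMap.snd ℝ _ _ + K.mulVecLin ∘ₗ LinearMap.fst ℝ _ _)))

theorem linearAccel_apply (M C K : Matrix (Fin n) (Fin n) ℝ) (z : (Fin n → ℝ) × (Fin n → ℝ)) :
    linearAccel M C K z = -(M⁻¹ *ᵥ (C *ᵥ z.2 + K *ᵥ z.1)) := rfl

variable {M : Matrix (Fin n) (Fin n) ℝ} (C K C₂ K₂ : Matrix (Fin n) (Fin n) ℝ)

theorem balance_iff (hM : IsUnit M) (a b : Fin n → ℝ) (z : (Fin n → ℝ) × (Fin n → ℝ)) :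
    M *ᵥ a + C *ᵥ z.2 + K *ᵥ z.1 = b ↔ a = M⁻¹ *ᵥ b + linearAccel M C K z := by
  have hdet := (Matrix.isUnit_iff_isUnit_det M).1 hM
  rw [linearAccel_apply]
  constructor
  · rintro rfl
    rw [← sub_eq_add_neg, ← mulVec_sub, add_assoc, add_sub_cancel_right, mulVec_mulVec,
      Matrix.nonsing_inv_mul M hdet, one_mulVec]
  · rintro rfl
    rw [← sub_eq_add_neg, ← mulVec_sub, mulVec_mulVec, Matrix.mul_nonsing_inv M hdet, one_mulVec]
    abel

theorem vectorField_eq (F : ℝ → Fin n → ℝ) (y : State n) :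
    vectorField M C K F y = (1, y.2.2, M⁻¹ *ᵥ F y.1 + linearAccel M C K y.2) := by
  rw [linearAccel_apply, ← sub_eq_add_neg, ← mulVec_sub, vectorField, ← mulVec_neg, neg_sub]

theorem linearAccel_compensated (h : ℝ) (z : (Fin n → ℝ) × (Fin n → ℝ)) :
    linearAccel M (C + h ^ 2 • C₂) (K + h ^ 2 • K₂) z =
      linearAccel M C K z + h ^ 2 • linearAccel M C₂ K₂ z := by
  simp only [linearAccel_apply, add_mulVec, smul_mulVec, mulVec_add, mulVec_smul]
  module

theorem isCompensatedStep_iff (hM : IsUnit M) (F F₂ : ℝ → Fin n → ℝ) (β γ h : ℝ)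
    (y y' : State n) :
    IsCompensatedStep M C K C₂ K₂ F F₂ β γ h y y' ↔ y'.1 = y.1 + h ∧
      residual (linearAccel M C K) (linearAccel M C₂ K₂) (fun t => M⁻¹ *ᵥ F t)
        (fun t => M⁻¹ *ᵥ F₂ t) β γ h y.1 y.2 y'.2 = 0 := by
  have hacc : ∀ (t : ℝ) (z : (Fin n → ℝ) × (Fin n → ℝ)),
      M⁻¹ *ᵥ (F t + h ^ 2 • F₂ t) + linearAccel M (C + h ^ 2 • C₂) (K + h ^ 2 • K₂) z =
      accel (linearAccel M C K) (linearAccel M C₂ K₂) (fun t => M⁻¹ *ᵥ F t)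
        (fun t => M⁻¹ *ᵥ F₂ t) h t z := fun t z => by
    rw [linearAccel_compensated, mulVec_add, mulVec_smul, accel]
    module
  unfold IsCompensatedStep IsStep
  simp only [balance_iff _ _ hM, hacc]
  constructor
  · rintro ⟨a, a', ha, ha', ht, hq, hv⟩
    refine ⟨ht, ?_⟩
    rw [ht] at ha'
    rw [residual, ← ha, ← ha', Prod.ext_iff]
    simp only [Prod.fst_sub, Prod.snd_sub, Prod.smul_fst, Prod.smul_snd, increment, hq, hv,
      Prod.fst_zero, Prod.snd_zero]
    constructor <;> module
  · rintro ⟨ht, hr⟩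
    refine ⟨_, _, rfl, rfl, ht, ?_, ?_⟩
    · have h1 := congrArg Prod.fst hr
      simp only [residual, Prod.fst_sub, Prod.smul_fst, increment, Prod.fst_zero] at h1
      rw [ht, ← sub_eq_zero, ← h1]
      module
    · have h1 := congrArg Prod.snd hr
      simp only [residual, Prod.snd_sub, Prod.smul_snd, increment, Prod.snd_zero] at h1
      rw [ht, ← sub_eq_zero, ← h1]
      module

theorem contDiff_mulVec (N : Matrix (Fin n) (Fin n) ℝ) {F : ℝ → Fin n → ℝ} {m : WithTop ℕ∞}
    (hF : ContDiff ℝ m F) : ContDiff ℝ m fun t => N *ᵥ F t :=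
  (LinearMap.toContinuousLinearMap N.mulVecLin).contDiff.comp hF

theorem deriv_mulVec (N : Matrix (Fin n) (Fin n) ℝ) {F : ℝ → Fin n → ℝ}
    (hF : Differentiable ℝ F) : (deriv fun t => N *ᵥ F t) = fun t => N *ᵥ deriv F t :=
  funext fun t => ((LinearMap.toContinuousLinearMap N.mulVecLin).hasFDerivAt.comp_hasDerivAt t
    (hF t).hasDerivAt).deriv

theorem jet_two {V : Type*} [NormedAddCommGroup V] [NormedSpace ℝ V] (L : V × V →L[ℝ] V)
    (f : ℝ → V) (t : ℝ) (z : V × V) : jet L f t z 2 = f t + L z := by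
  simp [jet]

theorem jet_three {V : Type*} [NormedAddCommGroup V] [NormedSpace ℝ V] (L : V × V →L[ℝ] V)
    (f : ℝ → V) (t : ℝ) (z : V × V) :
    jet L f t z 3 = deriv f t + L (z.2, f t + L z) := by
  change iteratedDeriv 1 f t + L (z.2, jet L f t z 2) = _
  rw [jet_two, iteratedDeriv_one]

theorem jet_four {V : Type*} [NormedAddCommGroup V] [NormedSpace ℝ V] (L : V × V →L[ℝ] V)
    (f : ℝ → V) (t : ℝ) (z : V × V) : jet L f t z 4 =
      deriv (deriv f) t + L (f t + L z, deriv f t + L (z.2, f t + L z)) := by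
  change iteratedDeriv 2 f t + L (jet L f t z 2, jet L f t z 3) = _
  rw [jet_two, jet_three, iteratedDeriv_succ, iteratedDeriv_one]

theorem A_eq_neg_jet {F : ℝ → Fin n → ℝ} (hF : Differentiable ℝ F) (t : ℝ) (q v : Fin n → ℝ) :
    A M C K F t q v = -jet (linearAccel M C K) (fun t => M⁻¹ *ᵥ F t) t (q, v) 3 := by
  rw [jet_three, deriv_mulVec _ hF, A]
  simp only [linearAccel_apply, mulVec_add, mulVec_neg, sub_mulVec, mulVec_mulVec,
    Matrix.mul_assoc]
  module

/-- The compensation is `-1 / 12` times the second derivative of the acceleration, which is the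
leading error of the scheme with `β = 1 / 6`, `γ = 1 / 2`. -/
theorem compensation_eq_jet {F : ℝ → Fin n → ℝ} (hF : ContDiff ℝ 4 F) (t : ℝ)
    (z : (Fin n → ℝ) × (Fin n → ℝ)) :
    M⁻¹ *ᵥ excitationTerm M C K F t +
        linearAccel M (dampingTerm M C K) (stiffnessTerm M C K) z =
      -(1 / 12 : ℝ) • jet (linearAccel M C K) (fun t => M⁻¹ *ᵥ F t) t z 4 := by
  have d0 : Differentiable ℝ F := hF.differentiable (by norm_num)
  have d1 : Differentiable ℝ (deriv F) := by
    have := hF.differentiable_iteratedDeriv 1 (by norm_num)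
    rwa [iteratedDeriv_one] at this
  rw [jet_four, deriv_mulVec _ d0, deriv_mulVec _ d1, excitationTerm, dampingTerm, stiffnessTerm]
  simp only [linearAccel_apply, mulVec_add, mulVec_neg, mulVec_sub, sub_mulVec, add_mulVec,
    smul_mulVec, mulVec_smul, mulVec_mulVec, Matrix.mul_assoc]
  module

/-- The flow of the vector field of the equation of motion: the time component advances at unit
speed, and positions and velocities follow a trajectory. -/
theorem eq_trajectory_of_flow {F : ℝ → Fin n → ℝ} {Z : ℝ → (Fin n → ℝ) × (Fin n → ℝ)}
    (hZ : IsTrajectory (linearAccel M C K) (fun t => M⁻¹ *ᵥ F t) Z) {τ h : ℝ} {y : ℝ → State n}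
    (h0 : y 0 = (τ, Z τ))
    (hy : ∀ t ∈ Set.Icc 0 h, HasDerivWithinAt y (vectorField M C K F (y t)) (Set.Icc 0 h) t)
    {t : ℝ} (ht : t ∈ Set.Icc 0 h) : y t = (τ + t, Z (τ + t)) := by
  simp only [vectorField_eq] at hy
  have htime : ∀ s ∈ Set.Icc 0 h, (y s).1 = τ + s := fun s hs => by
    have hd : ∀ r ∈ Set.Icc 0 h, HasDerivWithinAt (fun r => (y r).1 - r) 0 (Set.Icc 0 h) r :=
      fun r hr => by
        have := (ContinuousLinearMap.fst ℝ ℝ ((Fin n → ℝ) × (Fin n → ℝ))).hasFDerivAt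
          |>.comp_hasDerivWithinAt r (hy r hr)
        exact (this.sub (hasDerivWithinAt_id r _)).congr_deriv (by simp)
    have := norm_image_sub_le_of_norm_deriv_le_segment' hd (C := 0) (by simp) s hs
    rw [zero_mul, norm_le_zero_iff, h0] at this
    simp only [sub_zero] at this
    linarith
  refine Prod.ext (htime t ht) (hZ.eq_of_hasDerivWithinAt (z := fun t => (y t).2)
    (by simp [h0]) (fun s hs => ?_) ht)
  have := (ContinuousLinearMap.snd ℝ ℝ ((Fin n → ℝ) × (Fin n → ℝ))).hasFDerivAt
    |>.comp_hasDerivWithinAt s (hy s hs)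
  refine this.congr_deriv ?_
  simp [htime s hs]

theorem hasDerivAt_flow {F : ℝ → Fin n → ℝ} {Z : ℝ → (Fin n → ℝ) × (Fin n → ℝ)}
    (hZ : IsTrajectory (linearAccel M C K) (fun t => M⁻¹ *ᵥ F t) Z) (τ t : ℝ) :
    HasDerivAt (fun t => ((τ + t, Z (τ + t)) : State n))
      (vectorField M C K F (τ + t, Z (τ + t))) t := by
  rw [vectorField_eq]
  exact ((hasDerivAt_id t).const_add τ).prodMk ((hZ (τ + t)).comp_const_add τ t)

theorem IsMotion.eq_trajectory (hM : IsUnit M) {F : ℝ → Fin n → ℝ} {q₀ v₀ : Fin n → ℝ}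
    {q v : ℝ → Fin n → ℝ} (hqv : IsMotion M C K F q₀ v₀ q v)
    {Z : ℝ → (Fin n → ℝ) × (Fin n → ℝ)}
    (hZ : IsTrajectory (linearAccel M C K) (fun t => M⁻¹ *ᵥ F t) Z) (h0 : Z 0 = (q₀, v₀))
    {t : ℝ} (ht : 0 ≤ t) : (q t, v t) = Z t := by
  obtain ⟨hq, hv, H⟩ := hqv
  have := hZ.eq_of_hasDerivWithinAt (τ := 0) (b := t) (z := fun t => (q t, v t))
    (by simp [h0, hq, hv]) (fun s hs => ?_) ⟨ht, le_rfl⟩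
  · simpa using this
  · obtain ⟨h1, a, h2, h3⟩ := H s hs.1
    rw [balance_iff C K hM a (F s) (q s, v s)] at h3
    rw [zero_add, ← h3]
    exact (h1.prodMk h2).mono Set.Icc_subset_Ici_self

theorem IsTrajectory.isMotion (hM : IsUnit M) {F : ℝ → Fin n → ℝ}
    {Z : ℝ → (Fin n → ℝ) × (Fin n → ℝ)}
    (hZ : IsTrajectory (linearAccel M C K) (fun t => M⁻¹ *ᵥ F t) Z) :
    IsMotion M C K F (Z 0).1 (Z 0).2 (fun t => (Z t).1) (fun t => (Z t).2) := by
  refine ⟨rfl, rfl, fun t _ => ⟨?_, _, ?_, (balance_iff C K hM _ (F t) (Z t)).2 rfl⟩⟩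
  · exact ((ContinuousLinearMap.fst ℝ _ _).hasFDerivAt.comp_hasDerivAt t (hZ t)).hasDerivWithinAt
  · exact ((ContinuousLinearMap.snd ℝ _ _).hasFDerivAt.comp_hasDerivAt t (hZ t)).hasDerivWithinAt

end System

/-! ### Order four forces `β = 1 / 6` -/

section Order

variable {n : ℕ} {M C K : Matrix (Fin n) (Fin n) ℝ} {F : ℝ → Fin n → ℝ}

theorem exists_stepLength_le_half (L L₂ : (Fin n → ℝ) × (Fin n → ℝ) →L[ℝ] (Fin n → ℝ)) (β γ : ℝ) :
    ∃ h₀ : ℝ, 0 < h₀ ∧ h₀ ≤ 1 ∧ ∀ h ≤ h₀, h * stepLipschitz L L₂ β γ ≤ 1 / 2 := by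
  have h1 := one_le_stepLipschitz L L₂ β γ
  refine ⟨1 / (2 * stepLipschitz L L₂ β γ), by positivity, ?_, fun h hh => ?_⟩
  · rw [div_le_one (by positivity)]
    linarith
  · rw [le_div_iff₀ (by positivity)] at hh
    linarith

theorem beta_eq_of_isDistortedExpansion (hM : IsUnit M) (hF : ContDiff ℝ 4 F) {β : ℝ}
    {C₂ K₂ : Matrix (Fin n) (Fin n) ℝ} {F₂ : ℝ → Fin n → ℝ} (hF₂ : Continuous F₂)
    {τ : ℝ} {q v : Fin n → ℝ} (hA : A M C K F τ q v ≠ 0) {g : ℕ → State n → State n}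
    (hg : IsDistortedExpansion (IsCompensatedStep M C K C₂ K₂ F F₂ β (1 / 2)) 4 g)
    (g0 : g 0 = vectorField M C K F) (g1 : g 1 = 0) (g2 : g 2 = 0) (g3 : g 3 = 0) :
    β = 1 / 6 := by
  have hf : ContDiff ℝ 4 fun t => M⁻¹ *ᵥ F t := contDiff_mulVec M⁻¹ hF
  have hφ : Continuous fun t => M⁻¹ *ᵥ F₂ t := continuous_const.matrix_mulVec hF₂
  obtain ⟨Z, hZ, hZτ⟩ := exists_isTrajectory (linearAccel M C K) hf.continuous τ (q, v)
  rw [A_eq_neg_jet C K (hF.differentiable (by norm_num)), neg_ne_zero, ← hZτ] at hA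
  obtain ⟨c, h₀, hc, hh₀, H⟩ := hg.2 {(τ, Z τ)} isCompact_singleton
  obtain ⟨h₁, hh₁, hh₁', hΛ⟩ := exists_stepLength_le_half (linearAccel M C K)
    (linearAccel M C₂ K₂) β (1 / 2)
  refine hZ.beta_eq (L₂ := linearAccel M C₂ K₂) (γ := 1 / 2) (C := 2 * c) hf hφ hA fun ε hε => ?_
  obtain ⟨h, hh, hh'⟩ : ∃ h : ℝ, 0 < h ∧ h ≤ min (min h₀ h₁) (ε / 2) :=
    ⟨_, by positivity, le_rfl⟩
  simp only [le_min_iff] at hh'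
  obtain ⟨⟨l0, l1⟩, l2⟩ := hh'
  refine ⟨h, hh, by linarith, ?_⟩
  obtain ⟨x', y, hS, -, y0, dy, hy⟩ := H h hh l0 _ rfl
  rw [isCompensatedStep_iff _ _ _ _ hM] at hS
  have hle : h ≤ 1 := l1.trans hh₁'
  have hend : y h = (τ + h, Z (τ + h)) := by
    refine eq_trajectory_of_flow C K hZ y0 (fun t ht => ?_) ⟨hh.le, le_rfl⟩
    simpa [Finset.sum_range_succ, g0, g1, g2, g3] using dy t ht
  have hres := norm_residual_le _ _ _ _ _ _ hh.le hle (hΛ h l1) hS.2 (Z τ) (Z (τ + h))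
  have h2 : ‖x'.2 - Z (τ + h)‖ ≤ c * h ^ 5 := by
    rw [hend] at hy
    exact (norm_snd_le (x' - (τ + h, Z (τ + h)))).trans hy
  have h3 : c * h ^ 5 ≤ c * h ^ 4 :=
    mul_le_mul_of_nonneg_left (pow_le_pow_of_le_one hh.le hle (by norm_num)) hc.le
  rw [sub_self, norm_zero, zero_add] at hres
  linarith

theorem IsRun.time_eq {β γ h : ℝ} {C₂ K₂ : Matrix (Fin n) (Fin n) ℝ} {F₂ : ℝ → Fin n → ℝ}
    (hM : IsUnit M) {q₀ v₀ : Fin n → ℝ} {y : ℕ → State n}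
    (hy : IsRun (IsCompensatedStep M C K C₂ K₂ F F₂ β γ h) q₀ v₀ y) (j : ℕ) :
    (y j).1 = j * h := by
  induction j with
  | zero => simp [hy.1]
  | succ j ih =>
    rw [((isCompensatedStep_iff _ _ _ _ hM _ _ _ _ _ _ _).1 (hy.2 j)).1, ih]
    push_cast
    ring

/-- Every time `τ ≥ 0` is a grid point for arbitrarily small step lengths. -/
theorem exists_stepLength_mul_eq {τ : ℝ} (hτ : 0 ≤ τ) {ε : ℝ} (hε : 0 < ε) :
    ∃ (h : ℝ) (j : ℕ), 0 < h ∧ h < ε ∧ (j : ℝ) * h = τ := by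
  rcases hτ.eq_or_lt with rfl | hpos
  · exact ⟨ε / 2, 0, by positivity, by linarith, by simp⟩
  · obtain ⟨N, hN⟩ := exists_nat_gt (τ / ε)
    have hN0 : (0 : ℝ) < N := (by positivity : (0 : ℝ) < τ / ε).trans hN
    refine ⟨τ / N, N, by positivity, ?_, by field_simp⟩
    rw [div_lt_iff₀ hε] at hN
    rw [div_lt_iff₀ hN0]
    linarith

/-- Two consecutive grid values with errors `O(h ^ 4)` leave a residual `O(h ^ 4)` for the exact
trajectory, so that global accuracy of order four can be tested at a single step. -/
theorem beta_eq_of_isAccurateOfOrder (hM : IsUnit M) (hF : ContDiff ℝ 4 F) {β : ℝ}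
    {C₂ K₂ : Matrix (Fin n) (Fin n) ℝ} {F₂ : ℝ → Fin n → ℝ} (hF₂ : Continuous F₂)
    {τ : ℝ} {q v : Fin n → ℝ} (hτ : 0 ≤ τ) (hA : A M C K F τ q v ≠ 0)
    (hacc : IsAccurateOfOrder (IsCompensatedStep M C K C₂ K₂ F F₂ β (1 / 2)) M C K F 4) :
    β = 1 / 6 := by
  have hf : ContDiff ℝ 4 fun t => M⁻¹ *ᵥ F t := contDiff_mulVec M⁻¹ hF
  have hφ : Continuous fun t => M⁻¹ *ᵥ F₂ t := continuous_const.matrix_mulVec hF₂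
  obtain ⟨Z, hZ, hZτ⟩ := exists_isTrajectory (linearAccel M C K) hf.continuous τ (q, v)
  rw [A_eq_neg_jet C K (hF.differentiable (by norm_num)), neg_ne_zero, ← hZτ] at hA
  obtain ⟨c, h₀, hc, hh₀, H⟩ := hacc _ _ _ _ (hZ.isMotion C K hM) (τ + 1) (by linarith)
  obtain ⟨h₁, hh₁, hh₁', hΛ⟩ := exists_stepLength_le_half (linearAccel M C K)
    (linearAccel M C₂ K₂) β (1 / 2)
  refine hZ.beta_eq (L₂ := linearAccel M C₂ K₂) (γ := 1 / 2) (C := 4 * c) hf hφ hA fun ε hε => ?_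
  obtain ⟨h, j, hh, hlt, hj⟩ := exists_stepLength_mul_eq hτ (lt_min (lt_min hh₀ hh₁) hε)
  simp only [lt_min_iff] at hlt
  obtain ⟨⟨l0, l1⟩, l2⟩ := hlt
  refine ⟨h, hh, l2, ?_⟩
  have hle : h ≤ 1 := l1.le.trans hh₁'
  obtain ⟨y, hy, -, herr⟩ := H h hh l0.le
  have hS := ((isCompensatedStep_iff _ _ _ _ hM _ _ _ _ _ _ _).1 (hy.2 j)).2
  rw [hy.time_eq hM, hj] at hS
  have hj' : ((j + 1 : ℕ) : ℝ) * h = τ + h := by push_cast; rw [add_mul, hj, one_mul]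
  have e0 := herr j (by linarith)
  have e1 := herr (j + 1) (by linarith)
  rw [hj] at e0
  rw [hj'] at e1
  have d0 : ‖(y j).2 - Z τ‖ ≤ c * h ^ 4 := norm_prod_le_iff.2 e0
  have d1 : ‖(y (j + 1)).2 - Z (τ + h)‖ ≤ c * h ^ 4 := norm_prod_le_iff.2 e1
  have hres := norm_residual_le _ _ _ _ _ _ hh.le hle (hΛ h l1.le) hS (Z τ) (Z (τ + h))
  linarith

/-! ### Order four of the compensated scheme with `β = 1 / 6` -/

theorem existsUnique_isCompensatedStep (hM : IsUnit M) {β γ h : ℝ}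
    {C₂ K₂ : Matrix (Fin n) (Fin n) ℝ} {F₂ : ℝ → Fin n → ℝ} (h0 : 0 ≤ h) (h1 : h ≤ 1)
    (hΛ : h * stepLipschitz (linearAccel M C K) (linearAccel M C₂ K₂) β γ ≤ 1 / 2) (y : State n) :
    ∃! y', IsCompensatedStep M C K C₂ K₂ F F₂ β γ h y y' := by
  obtain ⟨z, hz, huniq⟩ := existsUnique_residual_eq_zero (linearAccel M C K)
    (linearAccel M C₂ K₂) (fun t => M⁻¹ *ᵥ F t) (fun t => M⁻¹ *ᵥ F₂ t) β γ h0 h1 hΛ y.1 y.2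
  refine ⟨(y.1 + h, z), (isCompensatedStep_iff _ _ _ _ hM _ _ _ _ _ _ _).2 ⟨rfl, hz⟩,
    fun w hw => ?_⟩
  obtain ⟨hw1, hw2⟩ := (isCompensatedStep_iff _ _ _ _ hM _ _ _ _ _ _ _).1 hw
  exact Prod.ext hw1 (huniq _ hw2)

theorem existsUnique_isRun {S : State n → State n → Prop} (hS : ∀ y, ∃! y', S y y')
    (q₀ v₀ : Fin n → ℝ) : ∃! y : ℕ → State n, IsRun S q₀ v₀ y := by
  choose next hnext huniq using hS
  refine ⟨fun j => next^[j] (0, q₀, v₀), ⟨rfl, fun j => ?_⟩, fun z hz => funext fun j => ?_⟩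
  · simp only [Function.iterate_succ_apply']
    exact hnext _
  · induction j with
    | zero => exact hz.1
    | succ j ih =>
      rw [Function.iterate_succ_apply', ← ih]
      exact huniq _ _ (hz.2 j)

theorem isDistortedExpansion_compensated (hM : IsUnit M) (hF : ContDiff ℝ 4 F)
    {g : ℕ → State n → State n} (g0 : g 0 = vectorField M C K F) (g1 : g 1 = 0) (g2 : g 2 = 0)
    (g3 : g 3 = 0) :
    IsDistortedExpansion (IsCompensatedStep M C K (dampingTerm M C K) (stiffnessTerm M C K) F
      (excitationTerm M C K F) (1 / 6) (1 / 2)) 4 g := by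
  have hf : ContDiff ℝ 4 fun t => M⁻¹ *ᵥ F t := contDiff_mulVec M⁻¹ hF
  refine ⟨fun k hk => ?_, fun Ω hΩ => ?_⟩
  · interval_cases k
    · have e : vectorField M C K F = fun y : State n =>
          (1, y.2.2, M⁻¹ *ᵥ F y.1 + linearAccel M C K y.2) := funext (vectorField_eq C K F)
      rw [g0, e]
      refine contDiff_const.prodMk (contDiff_snd.snd.prodMk (ContDiff.add ?_ ?_))
      · exact (hf.of_le (by norm_num)).comp contDiff_fst
      · exact (linearAccel M C K).contDiff.comp contDiff_snd
    · rw [g1]; exact contDiff_const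
    · rw [g2]; exact contDiff_const
    · rw [g3]; exact contDiff_const
  obtain ⟨R, hR⟩ := hΩ.isBounded.exists_norm_le
  obtain ⟨R', hR'⟩ := exists_norm_trajectory_le (linearAccel M C K) hf.continuous (-R) R R
  obtain ⟨B, hB0, hB⟩ := exists_norm_jet_le (linearAccel M C K) hf (-R) (R + 1) R'
  obtain ⟨h₀, hh₀, hh₀', hΛ⟩ := exists_stepLength_le_half (linearAccel M C K)
    (linearAccel M (dampingTerm M C K) (stiffnessTerm M C K)) (1 / 6) (1 / 2)
  refine ⟨4 * B + 1, h₀, by positivity, hh₀, fun h hh hle x hx => ?_⟩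
  have hle1 : h ≤ 1 := hle.trans hh₀'
  obtain ⟨Z, hZ, hZx⟩ := exists_isTrajectory (linearAccel M C K) hf.continuous x.1 x.2
  obtain ⟨x', hx', huniq⟩ := existsUnique_isCompensatedStep (F := F)
    (F₂ := excitationTerm M C K F) hM hh.le hle1 (hΛ h hle) x
  refine ⟨x', fun t => (x.1 + t, Z (x.1 + t)), hx', huniq, ?_, fun t _ => ?_, ?_⟩
  · simp [hZx]
  · have := (hasDerivAt_flow C K hZ x.1 t).hasDerivWithinAt (s := Set.Icc 0 h)
    simpa [Finset.sum_range_succ, g0, g1, g2, g3] using this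
  · rw [isCompensatedStep_iff _ _ _ _ hM, ← hZx] at hx'
    have hτ : x.1 ∈ Set.Icc (-R) R := abs_le.1 ((norm_fst_le x).trans (hR x hx))
    have hres := hZ.norm_residual_le hf (compensation_eq_jet C K hF) (t := x.1) (B := B) hh.le
      fun s hs k hk => hB s ⟨hτ.1.trans hs.1, by linarith [hs.2, hτ.2]⟩ _
        (hR' Z hZ x.1 hτ (by rw [hZx]; exact (norm_snd_le x).trans (hR x hx)) s
          ⟨hs.1, by linarith [hs.2]⟩) k hk
    have hst := norm_sub_le_of_residual _ _ _ _ _ _ hh.le hle1 (hΛ h hle) hx'.2 (Z x.1)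
      (Z (x.1 + h))
    rw [sub_self, norm_zero, mul_zero, zero_add] at hst
    have hp : 0 ≤ h ^ 5 := by positivity
    refine norm_prod_le_iff.2 ⟨?_, ?_⟩
    · simp only [Prod.fst_sub, hx'.1, sub_self, norm_zero]
      positivity
    · exact hst.trans (by linarith)

/-- The local errors `O(h ^ 5)` of the `O(1 / h)` steps accumulate to `O(h ^ 4)`. -/
theorem isAccurateOfOrder_compensated (hM : IsUnit M) (hF : ContDiff ℝ 4 F) :
    IsAccurateOfOrder (IsCompensatedStep M C K (dampingTerm M C K) (stiffnessTerm M C K) F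
      (excitationTerm M C K F) (1 / 6) (1 / 2)) M C K F 4 := by
  have hf : ContDiff ℝ 4 fun t => M⁻¹ *ᵥ F t := contDiff_mulVec M⁻¹ hF
  intro q₀ v₀ q v hqv T hT
  obtain ⟨Z, hZ, hZ0⟩ := exists_isTrajectory (linearAccel M C K) hf.continuous 0 (q₀, v₀)
  obtain ⟨R, hR⟩ := (isCompact_Icc (a := 0) (b := T)).exists_bound_of_continuousOn
    hZ.continuous.continuousOn
  obtain ⟨B, hB0, hB⟩ := exists_norm_jet_le (linearAccel M C K) hf 0 T R
  obtain ⟨h₀, hh₀, hh₀', hΛ⟩ := exists_stepLength_le_half (linearAccel M C K)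
    (linearAccel M (dampingTerm M C K) (stiffnessTerm M C K)) (1 / 6) (1 / 2)
  set a := 4 * stepLipschitz (linearAccel M C K)
    (linearAccel M (dampingTerm M C K) (stiffnessTerm M C K)) (1 / 6) (1 / 2) with ha
  have ha0 : 0 ≤ a := by
    have := one_le_stepLipschitz (linearAccel M C K)
      (linearAccel M (dampingTerm M C K) (stiffnessTerm M C K)) (1 / 6) (1 / 2)
    positivity
  refine ⟨4 * B * T * Real.exp (a * T) + 1, h₀, by positivity, hh₀, fun h hh hle => ?_⟩
  have hle1 : h ≤ 1 := hle.trans hh₀'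
  obtain ⟨y, hy, huniq⟩ := existsUnique_isRun (existsUnique_isCompensatedStep (F := F)
    (F₂ := excitationTerm M C K F) hM hh.le hle1 (hΛ h hle)) q₀ v₀
  refine ⟨y, hy, huniq, fun j hj => ?_⟩
  have err : ∀ j : ℕ, (j : ℝ) * h ≤ T →
      ‖(y j).2 - Z (j * h)‖ ≤ 4 * B * h ^ 5 * j * (1 + a * h) ^ j := by
    intro j
    induction j with
    | zero => intro _; simp [hy.1, hZ0]
    | succ j ih =>
      intro hj
      push_cast at hj
      have hjT : (j : ℝ) * h ≤ T := by linarith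
      have hj0 : 0 ≤ (j : ℝ) * h := by positivity
      have hS := ((isCompensatedStep_iff _ _ _ _ hM _ _ _ _ _ _ _).1 (hy.2 j)).2
      rw [hy.time_eq hM] at hS
      have hres := hZ.norm_residual_le hf (compensation_eq_jet C K hF) (t := j * h) (B := B) hh.le
        fun s hs k hk => by
          have hs' : s ∈ Set.Icc 0 T := ⟨hj0.trans hs.1, by linarith [hs.2]⟩
          exact hB s hs' _ (hR s hs') k hk
      have hst := norm_sub_le_of_residual _ _ _ _ _ _ hh.le hle1 (hΛ h hle) hS (Z (j * h))
        (Z (j * h + h))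
      rw [← ha] at hst
      have hpow : 1 ≤ (1 + a * h) ^ (j + 1) := one_le_pow₀ (by nlinarith)
      have hb : 0 ≤ 4 * B * h ^ 5 := by positivity
      push_cast
      rw [show ((j : ℝ) + 1) * h = j * h + h by ring]
      have h1 := mul_le_mul_of_nonneg_left (ih hjT) (by positivity : 0 ≤ 1 + a * h)
      have h2 := mul_le_mul_of_nonneg_left hpow hb
      calc _ ≤ (1 + a * h) * (4 * B * h ^ 5 * j * (1 + a * h) ^ j) + 4 * B * h ^ 5 := by linarith
        _ ≤ (1 + a * h) * (4 * B * h ^ 5 * j * (1 + a * h) ^ j) +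
            4 * B * h ^ 5 * (1 + a * h) ^ (j + 1) := by linarith
        _ = _ := by ring
  have hpow : (1 + a * h) ^ j ≤ Real.exp (a * T) := by
    calc (1 + a * h) ^ j ≤ Real.exp (a * h) ^ j := by
          gcongr
          linarith [Real.add_one_le_exp (a * h)]
      _ = Real.exp (a * (j * h)) := by rw [← Real.exp_nat_mul]; ring_nf
      _ ≤ _ := Real.exp_le_exp.2 (mul_le_mul_of_nonneg_left hj ha0)
  have total : ‖(y j).2 - Z (j * h)‖ ≤ (4 * B * T * Real.exp (a * T) + 1) * h ^ 4 := by
    have hp : 0 ≤ h ^ 4 := by positivity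
    calc _ ≤ 4 * B * h ^ 5 * j * (1 + a * h) ^ j := err j hj
      _ = 4 * B * h ^ 4 * (j * h) * (1 + a * h) ^ j := by ring
      _ ≤ 4 * B * h ^ 4 * T * Real.exp (a * T) := by gcongr
      _ ≤ _ := by linarith
  rw [← hqv.eq_trajectory C K hM hZ hZ0 (by positivity)] at total
  exact norm_prod_le_iff.1 total

end Order

end Newmark

theorem mainTheorem4 {n : ℕ} (M C K : Matrix (Fin n) (Fin n) ℝ) (hM : IsUnit M)
    (F : ℝ → Fin n → ℝ) (hF : ContDiff ℝ 4 F) :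
    -- for `γ = 1/2`, whatever the compensation, fourth order forces `β = 1/6`
    (∀ (β : ℝ) (C₂ K₂ : Matrix (Fin n) (Fin n) ℝ) (F₂ : ℝ → Fin n → ℝ), Continuous F₂ →
      ((∃ (τ : ℝ) (q v : Fin n → ℝ), Newmark.A M C K F τ q v ≠ 0) →
        ∀ g : ℕ → Newmark.State n → Newmark.State n,
          Newmark.IsDistortedExpansion
            (Newmark.IsCompensatedStep M C K C₂ K₂ F F₂ β (1 / 2)) 4 g →
          g 0 = Newmark.vectorField M C K F → g 1 = 0 → g 2 = 0 → g 3 = 0 → β = 1 / 6) ∧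
      ((∃ (τ : ℝ) (q v : Fin n → ℝ), 0 ≤ τ ∧ Newmark.A M C K F τ q v ≠ 0) →
        Newmark.IsAccurateOfOrder
          (Newmark.IsCompensatedStep M C K C₂ K₂ F F₂ β (1 / 2)) M C K F 4 → β = 1 / 6)) ∧
    -- for `γ = 1/2`, `β = 1/6`, the distorted vector field of the compensated scheme is the
    -- original vector field up to `O(h ^ 4)`
    (∀ g : ℕ → Newmark.State n → Newmark.State n,
      Newmark.IsDistortedExpansion
        (Newmark.IsCompensatedStep M C K (Newmark.dampingTerm M C K)
          (Newmark.stiffnessTerm M C K) F (Newmark.excitationTerm M C K F) (1 / 6) (1 / 2)) 4 g ↔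
      g 0 = Newmark.vectorField M C K F ∧ g 1 = 0 ∧ g 2 = 0 ∧ g 3 = 0) ∧
    -- and the compensated scheme is fourth-order accurate for the original system
    Newmark.IsAccurateOfOrder
      (Newmark.IsCompensatedStep M C K (Newmark.dampingTerm M C K)
        (Newmark.stiffnessTerm M C K) F (Newmark.excitationTerm M C K F) (1 / 6) (1 / 2))
      M C K F 4 := by
  refine ⟨fun β C₂ K₂ F₂ hF₂ => ⟨?_, ?_⟩, fun g => ⟨fun hg => ?_, ?_⟩, ?_⟩
  · rintro ⟨τ, q, v, hA⟩ g hg g0 g1 g2 g3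
    exact Newmark.beta_eq_of_isDistortedExpansion hM hF hF₂ hA hg g0 g1 g2 g3
  · rintro ⟨τ, q, v, hτ, hA⟩ hacc
    exact Newmark.beta_eq_of_isAccurateOfOrder hM hF hF₂ hτ hA hacc
  · have h := hg.unique (Newmark.isDistortedExpansion_compensated hM hF
      (g := fun k => if k = 0 then Newmark.vectorField M C K F else 0) rfl rfl rfl rfl)
    exact ⟨h 0 (by norm_num), h 1 (by norm_num), h 2 (by norm_num), h 3 (by norm_num)⟩
  · rintro ⟨g0, g1, g2, g3⟩
    exact Newmark.isDistortedExpansion_compensated hM hF g0 g1 g2 g3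
  · exact Newmark.isAccurateOfOrder_compensated hM hF
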